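/- Let $\mathbb K$ be $\mathbb R$ or $\mathbb C$, and let $G$ be a locally compact Hausdorff group with identity $e$, a fixed left Haar measure $ds$, and modular function $\Delta$, normalised by $\Delta(r)\int_G f(sr)\,ds=\int_G f(s)\,ds$. A strongly continuous representation of $G$ on a Banach space $X$ is a homomorphism $U:r\mapsto U_r$ from $G$ into the group of invertible bounded operators on $X$ such that $r\mapsto U_rx$ is continuous for all $x\in X$. Let $\mathcal Z$ be a neighbourhood basis of $e$ contained in a fixed compact set, and let $\nu:G\to[0,\infty)$ be bounded on compact sets and satisfy $\inf_{V\in\mathcal Z}\sup_{r\in V}\nu(r)=1$. Let $\mathcal R$ be a non-empty class of strongly continuous representations of $G$ on Banach spaces over $\mathbb K$ such that $\|U_r\|\le\nu(r)$ for all $U\in\mathcal R$ and $r\in G$. Let $\mathcal X$ be a class of Banach spaces over $\mathbb K$, and suppose that $\mathcal R$ contains the class $\mathcal R'$ of all strongly continuous representations $U$ of $G$ in spaces from $\mathcal X$ such that $\|U_r\|\le\nu(r)$ for all $r\in G$. For a strongly continuous representation $U$ and $f\in C_c(G)$ put $U(f)=\int_G f(s)U_s\,ds$ (a strong operator integral).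 Let $\sigma^{\mathcal R}(f)=\sup_{U\in\mathcal R}\|U(f)\|$, which is a (finite) algebra seminorm on the convolution algebra $C_c(G)=C_c(G,\mathbb K)$; let the Banach algebra $(\mathbb K\rtimes_{\mathrm{triv}}G)^{\mathcal R}$ be the completion of $C_c(G)/\ker\sigma^{\mathcal R}$ in the norm induced by $\sigma^{\mathcal R}$, and let $q^{\mathcal R}$ be the canonical map from $C_c(G)$ into it. For $U\in\mathcal R$, let $U^{\mathcal R}$ be the bounded representation of $(\mathbb K\rtimes_{\mathrm{triv}}G)^{\mathcal R}$ determined by $U^{\mathcal R}(q^{\mathcal R}(f))=U(f)$ for $f\in C_c(G)$. A representation $T$ of an algebra $B$ on $X$ is called non-degenerate if the linear span of $\{T(a)x: a\in B,\ x\in X\}$ is dense in $X$. Then the map $U\mapsto U^{\mathcal R}$ is a bijection between $\mathcal R'$ and the class of non-degenerate contractive representations of $(\mathbb K\rtimes_{\mathrm{triv}}G)^{\mathcal R}$ in the Banach spaces from $\mathcal X$. It preserves the set of closed invariant subspaces: for $U\in\mathcal R'$, a closed subspace is invariant under all $U_r$ if and only if it is invariant under $U^{\mathcal R}$. It preserves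 the Banach space of bounded intertwining operators between two elements of $\mathcal R'$: for $U,V\in\mathcal R'$, a bounded operator intertwines $U$ and $V$ if and only if it intertwines $U^{\mathcal R}$ and $V^{\mathcal R}$. If all elements of $\mathcal R$ are unitary representations on Hilbert spaces, then the involution $f^*(s)=\Delta(s^{-1})\overline{f(s^{-1})}$ of $C_c(G)$ induces an involution on $(\mathbb K\rtimes_{\mathrm{triv}}G)^{\mathcal R}$ satisfying $\|a^*a\|=\|a\|^2$ (so that it is a $C^*$-algebra if $\mathbb K=\mathbb C$), and, for $U\in\mathcal R'$, $U$ is unitary if and only if $U^{\mathcal R}$ is involutive. -/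

import Mathlib

open MeasureTheory Topology NNReal CompactlySupported

noncomputable section

/-! ### Banach spaces and strongly continuous group representations -/

/-- A bundled Banach space over `𝕂`, so that a class of Banach spaces is a `Set (BanachSp 𝕂)`. -/
structure BanachSp.{w, v} (𝕂 : Type w) [RCLike 𝕂] : Type (max w (v + 1)) where
  carrier : Type v
  [normedAddCommGroup : NormedAddCommGroup carrier]
  [normedSpace : NormedSpace 𝕂 carrier]
  [completeSpace : CompleteSpace carrier]

instance BanachSp.instCoeSort {𝕂 : Type*} [RCLike 𝕂] : CoeSort (BanachSp 𝕂) (Type _) :=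
  ⟨BanachSp.carrier⟩

attribute [instance] BanachSp.normedAddCommGroup BanachSp.normedSpace BanachSp.completeSpace

/-- The underlying real Banach space (needed for the integral). -/
instance BanachSp.instRealNormedSpace {𝕂 : Type*} [RCLike 𝕂] (X : BanachSp 𝕂) :
    NormedSpace ℝ X :=
  NormedSpace.restrictScalars ℝ 𝕂 X

instance BanachSp.instRealScalarTower {𝕂 : Type*} [RCLike 𝕂] (X : BanachSp 𝕂) :
    IsScalarTower ℝ 𝕂 X :=
  IsScalarTower.restrictScalars ℝ 𝕂 X

instance BanachSp.instRealSMulComm {𝕂 : Type*} [RCLike 𝕂] (X : BanachSp 𝕂) :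
    SMulCommClass ℝ 𝕂 X :=
  ⟨fun a b x => by
    change (algebraMap ℝ 𝕂 a) • b • x = b • (algebraMap ℝ 𝕂 a) • x
    rw [smul_comm]⟩

/-- A strongly continuous representation of the group `G` on the Banach space `X`: a homomorphism
into the invertible bounded operators, with continuous orbit maps. -/
structure StrongContRep (G : Type*) [Group G] [TopologicalSpace G] {𝕂 : Type*} [RCLike 𝕂]
    (X : BanachSp 𝕂) where
  toHom : G →* (X →L[𝕂] X)ˣ
  continuous_orbit : ∀ x : X, Continuous fun r : G => (toHom r : X →L[𝕂] X) x

/-- The bounded operator `U_r`. -/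
def StrongContRep.op {G : Type*} [Group G] [TopologicalSpace G] {𝕂 : Type*} [RCLike 𝕂]
    {X : BanachSp 𝕂} (U : StrongContRep G X) (r : G) : X →L[𝕂] X :=
  (U.toHom r : X →L[𝕂] X)

/-- Strongly continuous representations of `G` on arbitrary Banach spaces (together with the
space); a class of strongly continuous representations is a set of these. -/
abbrev SomeRep.{u, w, v} (G : Type u) [Group G] [TopologicalSpace G] (𝕂 : Type w) [RCLike 𝕂] :
    Type (max u w (v + 1)) :=
  Σ X : BanachSp.{w, v} 𝕂, StrongContRep G X

/-- A class of representations is uniformly bounded if it is dominated by some function that is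
bounded on compact sets. -/
def UniformlyBoundedClass {G : Type*} [Group G] [TopologicalSpace G] {𝕂 : Type*} [RCLike 𝕂]
    (R : Set (SomeRep G 𝕂)) : Prop :=
  ∃ ν : G → ℝ≥0, (∀ K : Set G, IsCompact K → BddAbove (ν '' K)) ∧
    ∀ U ∈ R, ∀ r : G, ‖U.2.op r‖ ≤ ν r

section Integrated

open scoped Pointwise

variable {G : Type*} [Group G] [TopologicalSpace G] [IsTopologicalGroup G]
  [MeasurableSpace G] [BorelSpace G] {𝕂 : Type*} [RCLike 𝕂] {X : BanachSp 𝕂}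

theorem StrongContRep.op_mul (U : StrongContRep G X) (r s : G) (x : X) :
    U.op (r * s) x = U.op r (U.op s x) := by
  simp [StrongContRep.op]

theorem StrongContRep.continuous_op (U : StrongContRep G X) (x : X) :
    Continuous fun r => U.op r x :=
  U.continuous_orbit x

theorem StrongContRep.exists_bound (U : StrongContRep G X) {K : Set G} (hK : IsCompact K) :
    ∃ M : ℝ, 0 ≤ M ∧ ∀ r ∈ K, ‖U.op r‖ ≤ M := by
  have h := banach_steinhaus (g := fun r : K => U.op r) (fun x => by
    obtain ⟨C, hC⟩ := hK.exists_bound_of_continuousOn (U.continuous_op x).continuousOn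
    exact ⟨C, fun r => hC r r.2⟩)
  obtain ⟨M, hM⟩ := h
  exact ⟨max M 0, le_max_right _ _, fun r hr => (hM ⟨r, hr⟩).trans (le_max_left _ _)⟩

theorem StrongContRep.integrable (U : StrongContRep G X) (μ : Measure G)
    [IsFiniteMeasureOnCompacts μ] (f : C_c(G, 𝕂)) (x : X) :
    Integrable (fun s => f s • U.op s x) μ :=
  ((map_continuous f).smul (U.continuous_op x)).integrable_of_hasCompactSupport
    f.hasCompactSupport.smul_right

theorem StrongContRep.norm_integral_le (U : StrongContRep G X) (μ : Measure G)
    [IsFiniteMeasureOnCompacts μ] (f : C_c(G, 𝕂)) (x : X) {M : ℝ}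
    (hM : ∀ r ∈ tsupport f, ‖U.op r‖ ≤ M) :
    ‖∫ s, f s • U.op s x ∂μ‖ ≤ (M * ∫ s, ‖f s‖ ∂μ) * ‖x‖ := by
  have hf : Integrable (fun s => ‖f s‖) μ :=
    ((map_continuous f).integrable_of_hasCompactSupport f.hasCompactSupport).norm
  calc ‖∫ s, f s • U.op s x ∂μ‖ ≤ ∫ s, ‖f s • U.op s x‖ ∂μ := norm_integral_le_integral_norm _
    _ ≤ ∫ s, (M * ‖x‖) * ‖f s‖ ∂μ := by
        refine integral_mono (U.integrable μ f x).norm (hf.const_mul _) fun s => ?_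
        by_cases hs : s ∈ tsupport f
        · have h1 : ‖U.op s x‖ ≤ M * ‖x‖ := (U.op s).le_of_opNorm_le (hM s hs) x
          calc ‖f s • U.op s x‖ = ‖U.op s x‖ * ‖f s‖ := by rw [norm_smul, mul_comm]
            _ ≤ (M * ‖x‖) * ‖f s‖ := by gcongr
        · simp [image_eq_zero_of_notMem_tsupport hs]
    _ = (M * ∫ s, ‖f s‖ ∂μ) * ‖x‖ := by rw [integral_const_mul]; ring

/-- The integrated form `U(f) = ∫ f(s) U_s ds`, the integral being taken in the strong sense:
`U(f) x = ∫ f(s) U_s x ds`. -/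
def StrongContRep.integrate (μ : Measure G) [IsFiniteMeasureOnCompacts μ]
    (U : StrongContRep G X) (f : C_c(G, 𝕂)) : X →L[𝕂] X :=
  LinearMap.mkContinuousOfExistsBound
    { toFun := fun x => ∫ s, f s • U.op s x ∂μ
      map_add' := fun x y => by
        simp only [map_add, smul_add]
        exact integral_add (U.integrable μ f x) (U.integrable μ f y)
      map_smul' := fun c x => by
        simp only [map_smul, smul_comm _ c, RingHom.id_apply]
        exact integral_smul c _ }
    (by
      obtain ⟨M, -, hM⟩ := U.exists_bound f.hasCompactSupport.isCompact
      exact ⟨_, fun x => U.norm_integral_le μ f x hM⟩)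

theorem StrongContRep.integrate_apply (μ : Measure G) [IsFiniteMeasureOnCompacts μ]
    (U : StrongContRep G X) (f : C_c(G, 𝕂)) (x : X) :
    U.integrate μ f x = ∫ s, f s • U.op s x ∂μ := rfl

theorem StrongContRep.norm_integrate_le (μ : Measure G) [IsFiniteMeasureOnCompacts μ]
    (U : StrongContRep G X) (f : C_c(G, 𝕂)) {M : ℝ} (h0 : 0 ≤ M)
    (hM : ∀ r ∈ tsupport f, ‖U.op r‖ ≤ M) :
    ‖U.integrate μ f‖ ≤ M * ∫ s, ‖f s‖ ∂μ :=
  ContinuousLinearMap.opNorm_le_bound _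
    (mul_nonneg h0 (integral_nonneg fun _ => norm_nonneg _))
    fun x => U.norm_integral_le μ f x hM

theorem StrongContRep.integrate_add (μ : Measure G) [IsFiniteMeasureOnCompacts μ]
    (U : StrongContRep G X) (f g : C_c(G, 𝕂)) :
    U.integrate μ (f + g) = U.integrate μ f + U.integrate μ g := by
  ext x
  simp only [integrate_apply, _root_.add_apply,
    CompactlySupportedContinuousMap.coe_add, Pi.add_apply, add_smul]
  exact integral_add (U.integrable μ f x) (U.integrable μ g x)

theorem StrongContRep.integrate_smul (μ : Measure G) [IsFiniteMeasureOnCompacts μ]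
    (U : StrongContRep G X) (c : 𝕂) (f : C_c(G, 𝕂)) :
    U.integrate μ (c • f) = c • U.integrate μ f := by
  ext x
  simp only [integrate_apply, _root_.smul_apply,
    CompactlySupportedContinuousMap.coe_smul, Pi.smul_apply, smul_assoc]
  exact integral_smul c _

/-! ### Convolution on `C_c(G)` -/

theorem convolution_continuous [LocallyCompactSpace G] (μ : Measure G)
    [IsFiniteMeasureOnCompacts μ] (f g : C_c(G, 𝕂)) :
    Continuous fun s => ∫ r, f r * g (r⁻¹ * s) ∂μ := by
  rw [← continuousOn_univ]
  refine continuousOn_integral_of_compact_support (k := tsupport f)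
    f.hasCompactSupport.isCompact ?_ ?_
  · refine Continuous.continuousOn ?_
    exact ((map_continuous f).comp continuous_snd).mul
      ((map_continuous g).comp (continuous_snd.inv.mul continuous_fst))
  · intro s r _ hr
    simp [image_eq_zero_of_notMem_tsupport hr]

/-- The convolution product `(f * g)(s) = ∫ f(r) g(r⁻¹ s) dr` on `C_c(G)`. -/
def groupConvolution [LocallyCompactSpace G] (μ : Measure G)
    [IsFiniteMeasureOnCompacts μ] (f g : C_c(G, 𝕂)) : C_c(G, 𝕂) where
  toFun := fun s => ∫ r, f r * g (r⁻¹ * s) ∂μ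
  continuous_toFun := convolution_continuous μ f g
  hasCompactSupport' := by
    refine HasCompactSupport.intro
      (f.hasCompactSupport.isCompact.mul g.hasCompactSupport.isCompact) fun s hs => ?_
    refine integral_eq_zero_of_ae (Filter.Eventually.of_forall fun r => ?_)
    by_cases hr : r ∈ tsupport f
    · have : r⁻¹ * s ∉ tsupport g := fun h => hs ⟨r, hr, r⁻¹ * s, h, by simp⟩
      simp [image_eq_zero_of_notMem_tsupport this]
    · simp [image_eq_zero_of_notMem_tsupport hr]


theorem integral_groupConvolution_smul [LocallyCompactSpace G] (μ : Measure G) [μ.IsHaarMeasure]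
    (f g : C_c(G, 𝕂)) {E : Type*} [NormedAddCommGroup E] [NormedSpace ℝ E] [NormedSpace 𝕂 E]
    [CompleteSpace E] [IsScalarTower ℝ 𝕂 E] [SMulCommClass ℝ 𝕂 E] {φ : G → E}
    (hφ : Continuous φ) :
    ∫ s, groupConvolution μ f g s • φ s ∂μ = ∫ r, f r • ∫ s, g s • φ (r * s) ∂μ ∂μ := by
  have hsupp : ∀ p : G × G, p ∉ (tsupport f * tsupport g) ×ˢ tsupport f →
      (f p.2 * g (p.2⁻¹ * p.1)) • φ p.1 = 0 := by
    rintro ⟨s, r⟩ h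
    by_cases hr : r ∈ tsupport f
    · have : r⁻¹ * s ∉ tsupport g := fun h' => h ⟨⟨r, hr, r⁻¹ * s, h', by simp⟩, hr⟩
      simp [image_eq_zero_of_notMem_tsupport this]
    · simp [image_eq_zero_of_notMem_tsupport hr]
  calc ∫ s, groupConvolution μ f g s • φ s ∂μ
      = ∫ s, ∫ r, (f r * g (r⁻¹ * s)) • φ s ∂μ ∂μ := by
        congr 1 with s
        exact (integral_smul_const _ _).symm
    _ = ∫ r, ∫ s, (f r * g (r⁻¹ * s)) • φ s ∂μ ∂μ := by
        apply integral_integral_swap_of_hasCompactSupport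
        · exact (((map_continuous f).comp continuous_snd).mul
            ((map_continuous g).comp (continuous_snd.inv.mul continuous_fst))).smul
            (hφ.comp continuous_fst)
        · exact HasCompactSupport.of_support_subset_isCompact
            ((f.hasCompactSupport.isCompact.mul g.hasCompactSupport.isCompact).prod
              f.hasCompactSupport.isCompact)
            (fun p hp => by by_contra h; exact hp (hsupp p h))
    _ = ∫ r, f r • ∫ s, g s • φ (r * s) ∂μ ∂μ := by
        congr 1 with r
        simp only [mul_smul]
        rw [integral_smul]
        congr 1
        rw [← integral_mul_left_eq_self _ r]
        simp

theorem groupConvolution_assoc [LocallyCompactSpace G] (μ : Measure G) [μ.IsHaarMeasure]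
    (f g h : C_c(G, 𝕂)) :
    groupConvolution μ (groupConvolution μ f g) h =
      groupConvolution μ f (groupConvolution μ g h) := by
  ext t
  have := integral_groupConvolution_smul μ f g (φ := fun s => h (s⁻¹ * t))
    ((map_continuous h).comp (continuous_inv.mul continuous_const))
  simpa [groupConvolution, mul_assoc] using this

theorem StrongContRep.integrate_groupConvolution [LocallyCompactSpace G] (μ : Measure G)
    [μ.IsHaarMeasure] (U : StrongContRep G X) (f g : C_c(G, 𝕂)) :
    U.integrate μ (groupConvolution μ f g) = U.integrate μ f * U.integrate μ g := by
  ext x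
  change U.integrate μ _ x = U.integrate μ f (U.integrate μ g x)
  simp only [integrate_apply]
  rw [integral_groupConvolution_smul μ f g (U.continuous_op x)]
  congr 1 with r
  congr 1
  rw [← ContinuousLinearMap.integral_comp_comm _ (U.integrable μ g x)]
  simp [U.op_mul]

theorem convolution_integrable (μ : Measure G) [IsFiniteMeasureOnCompacts μ] (f g : C_c(G, 𝕂))
    (s : G) : Integrable (fun r => f r * g (r⁻¹ * s)) μ :=
  ((map_continuous f).mul ((map_continuous g).comp
    (continuous_inv.mul continuous_const))).integrable_of_hasCompactSupport
    f.hasCompactSupport.mul_right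

end Integrated

/-! ### The completion of a non-unital seminormed algebra -/

section Completion

open UniformSpace

variable {A : Type*} [NonUnitalSeminormedRing A]

/-- Left multiplication, valued in the completion, as a continuous biadditive map. -/
theorem completion_continuous_mul :
    Continuous fun p : A × A => ((AddMonoidHom.mul : A →+ A →+ A).compr₂ Completion.toCompl)
      p.1 p.2 :=
  (Completion.continuous_coe A).comp continuous_mul

/-- The multiplication of the completion: the continuous extension of that of `A`. -/
def completionMul (a b : Completion A) : Completion A :=
  (Completion.isDenseInducing_coe.prodMap Completion.isDenseInducing_coe).extend
    (fun p : A × A => ((p.1 * p.2 : A) : Completion A)) (a, b)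

theorem completionMul_coe (a b : A) :
    completionMul (a : Completion A) (b : Completion A) = ((a * b : A) : Completion A) :=
  (Completion.isDenseInducing_coe.prodMap Completion.isDenseInducing_coe).extend_eq
    ((Completion.continuous_coe A).comp continuous_mul) (a, b)

theorem continuous_completionMul :
    Continuous fun p : Completion A × Completion A => completionMul p.1 p.2 :=
  have di : IsDenseInducing (Completion.toCompl : A → Completion A) :=
    Completion.isDenseInducing_coe
  (di.extend_Z_bilin di completion_continuous_mul :)

theorem continuous_completionMul' {Y : Type*} [TopologicalSpace Y] {f g : Y → Completion A}
    (hf : Continuous f) (hg : Continuous g) : Continuous fun y => completionMul (f y) (g y) :=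
  continuous_completionMul.comp (hf.prodMk hg)

theorem completionMul_add (a b c : Completion A) :
    completionMul a (b + c) = completionMul a b + completionMul a c := by
  refine Completion.induction_on₃ a b c (isClosed_eq ?_ ?_) fun a b c => ?_
  · refine continuous_completionMul' ?_ ?_ <;> fun_prop
  · refine Continuous.add ?_ ?_ <;> refine continuous_completionMul' ?_ ?_ <;> fun_prop
  · rw [← Completion.coe_add, completionMul_coe, completionMul_coe, completionMul_coe, mul_add,
      Completion.coe_add]

theorem add_completionMul (a b c : Completion A) :
    completionMul (a + b) c = completionMul a c + completionMul b c := by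
  refine Completion.induction_on₃ a b c (isClosed_eq ?_ ?_) fun a b c => ?_
  · refine continuous_completionMul' ?_ ?_ <;> fun_prop
  · refine Continuous.add ?_ ?_ <;> refine continuous_completionMul' ?_ ?_ <;> fun_prop
  · rw [← Completion.coe_add, completionMul_coe, completionMul_coe, completionMul_coe, add_mul,
      Completion.coe_add]

/-- The completion of a non-unital seminormed ring is a non-unital normed ring. -/
@[reducible]
def completionNonUnitalNormedRing : NonUnitalNormedRing (Completion A) where
  __ : NormedAddCommGroup (Completion A) := inferInstance
  mul := completionMul
  left_distrib := completionMul_add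
  right_distrib := add_completionMul
  zero_mul a := by
    refine Completion.induction_on a (isClosed_eq
      (continuous_completionMul' continuous_const continuous_id) continuous_const) fun a => ?_
    change completionMul 0 _ = 0
    rw [← Completion.coe_zero, completionMul_coe, zero_mul]
  mul_zero a := by
    refine Completion.induction_on a (isClosed_eq
      (continuous_completionMul' continuous_id continuous_const) continuous_const) fun a => ?_
    change completionMul _ 0 = 0
    rw [← Completion.coe_zero, completionMul_coe, mul_zero]
  mul_assoc a b c := by
    refine Completion.induction_on₃ a b c (isClosed_eq
      (continuous_completionMul' (continuous_completionMul' (by fun_prop) (by fun_prop))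
        (by fun_prop))
      (continuous_completionMul' (by fun_prop)
        (continuous_completionMul' (by fun_prop) (by fun_prop)))) fun a b c => ?_
    change completionMul (completionMul _ _) _ = completionMul _ (completionMul _ _)
    rw [completionMul_coe, completionMul_coe, completionMul_coe, completionMul_coe, mul_assoc]
  norm_mul_le a b := by
    refine Completion.induction_on₂ a b (isClosed_le
      (continuous_completionMul' (by fun_prop) (by fun_prop)).norm (by fun_prop)) fun a b => ?_
    change ‖completionMul _ _‖ ≤ _
    rw [completionMul_coe, Completion.norm_coe, Completion.norm_coe, Completion.norm_coe]
    exact norm_mul_le a b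

theorem completionMul_smul_left {𝕜 : Type*} [NormedField 𝕜] [NormedSpace 𝕜 A]
    [IsScalarTower 𝕜 A A] (c : 𝕜) (a b : Completion A) :
    completionMul (c • a) b = c • completionMul a b := by
  refine Completion.induction_on₂ a b (isClosed_eq ?_ ?_) fun a b => ?_
  · exact continuous_completionMul' (continuous_fst.const_smul c) continuous_snd
  · exact continuous_completionMul.const_smul c
  · rw [← Completion.coe_smul, completionMul_coe, completionMul_coe, smul_mul_assoc,
      Completion.coe_smul]

theorem completionMul_smul_right {𝕜 : Type*} [NormedField 𝕜] [NormedSpace 𝕜 A]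
    [SMulCommClass 𝕜 A A] (c : 𝕜) (a b : Completion A) :
    completionMul a (c • b) = c • completionMul a b := by
  refine Completion.induction_on₂ a b (isClosed_eq ?_ ?_) fun a b => ?_
  · exact continuous_completionMul' continuous_fst (continuous_snd.const_smul c)
  · exact continuous_completionMul.const_smul c
  · rw [← Completion.coe_smul, completionMul_coe, completionMul_coe, mul_smul_comm,
      Completion.coe_smul]

end Completion

/-! ### The seminorm and the convolution algebra -/

section Algebra

variable {G : Type*} [Group G] [TopologicalSpace G] [IsTopologicalGroup G] [LocallyCompactSpace G]
  [MeasurableSpace G] [BorelSpace G] {𝕂 : Type*} [RCLike 𝕂]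

/-- The seminorm `σ(f) = sup_{U ∈ R} ‖U(f)‖` on `C_c(G)`. -/
def classSeminorm (μ : Measure G) [IsFiniteMeasureOnCompacts μ] (R : Set (SomeRep G 𝕂))
    (f : C_c(G, 𝕂)) : ℝ :=
  ⨆ U : R, ‖U.1.2.integrate μ f‖

theorem classSeminorm_bddAbove (μ : Measure G) [IsFiniteMeasureOnCompacts μ]
    {R : Set (SomeRep G 𝕂)} (hR : UniformlyBoundedClass R) (f : C_c(G, 𝕂)) :
    BddAbove (Set.range fun U : R => ‖U.1.2.integrate μ f‖) := by
  obtain ⟨ν, hν, hU⟩ := hR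
  obtain ⟨M, hM⟩ := hν _ f.hasCompactSupport.isCompact
  refine ⟨M * ∫ s, ‖f s‖ ∂μ, ?_⟩
  rintro _ ⟨U, rfl⟩
  exact U.1.2.norm_integrate_le μ f M.2 fun r hr =>
    (hU U.1 U.2 r).trans (NNReal.coe_le_coe.2 (hM ⟨r, hr, rfl⟩))

theorem norm_integrate_le_classSeminorm (μ : Measure G) [IsFiniteMeasureOnCompacts μ]
    {R : Set (SomeRep G 𝕂)} (hR : UniformlyBoundedClass R) {U : SomeRep G 𝕂} (hU : U ∈ R)
    (f : C_c(G, 𝕂)) : ‖U.2.integrate μ f‖ ≤ classSeminorm μ R f :=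
  le_ciSup (classSeminorm_bddAbove μ hR f) (⟨U, hU⟩ : R)

theorem classSeminorm_nonneg (μ : Measure G) [IsFiniteMeasureOnCompacts μ]
    (R : Set (SomeRep G 𝕂)) (f : C_c(G, 𝕂)) : 0 ≤ classSeminorm μ R f :=
  Real.iSup_nonneg fun _ => norm_nonneg _

/-- The convolution algebra `C_c(G)`, to be equipped with the seminorm given by `R`. -/
def ConvAlg (μ : Measure G) [μ.IsHaarMeasure] (R : Set (SomeRep G 𝕂))
    (_hR : UniformlyBoundedClass R) : Type _ :=
  C_c(G, 𝕂)

variable (μ : Measure G) [μ.IsHaarMeasure] (R : Set (SomeRep G 𝕂)) (hR : UniformlyBoundedClass R)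

instance ConvAlg.instAddCommGroup : AddCommGroup (ConvAlg μ R hR) :=
  inferInstanceAs (AddCommGroup C_c(G, 𝕂))

instance ConvAlg.instModule : Module 𝕂 (ConvAlg μ R hR) :=
  inferInstanceAs (Module 𝕂 C_c(G, 𝕂))

/-- The multiplication of the convolution algebra is convolution. -/
instance ConvAlg.instMul : Mul (ConvAlg μ R hR) :=
  ⟨fun f g => groupConvolution (𝕂 := 𝕂) μ f g⟩

instance ConvAlg.instNonUnitalRing : NonUnitalRing (ConvAlg μ R hR) where
  __ := ConvAlg.instAddCommGroup μ R hR
  __ := ConvAlg.instMul μ R hR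
  left_distrib f g h := CompactlySupportedContinuousMap.ext (α := G) (β := 𝕂) fun s => by
    refine Eq.trans ?_ (integral_add (convolution_integrable (𝕂 := 𝕂) μ f g s)
      (convolution_integrable (𝕂 := 𝕂) μ f h s))
    exact integral_congr_ae (Filter.Eventually.of_forall fun r => mul_add _ _ _)
  right_distrib f g h := CompactlySupportedContinuousMap.ext (α := G) (β := 𝕂) fun s => by
    refine Eq.trans ?_ (integral_add (convolution_integrable (𝕂 := 𝕂) μ f h s)
      (convolution_integrable (𝕂 := 𝕂) μ g h s))
    exact integral_congr_ae (Filter.Eventually.of_forall fun r => add_mul _ _ _)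
  zero_mul f := CompactlySupportedContinuousMap.ext (α := G) (β := 𝕂) fun s =>
    integral_eq_zero_of_ae (Filter.Eventually.of_forall fun r => zero_mul _)
  mul_zero f := CompactlySupportedContinuousMap.ext (α := G) (β := 𝕂) fun s =>
    integral_eq_zero_of_ae (Filter.Eventually.of_forall fun r => mul_zero _)
  mul_assoc f g h := groupConvolution_assoc (𝕂 := 𝕂) μ f g h

instance ConvAlg.instIsScalarTower : IsScalarTower 𝕂 (ConvAlg μ R hR) (ConvAlg μ R hR) where
  smul_assoc c f g := CompactlySupportedContinuousMap.ext (α := G) (β := 𝕂) fun s => by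
    refine Eq.trans ?_ (integral_smul c _)
    exact integral_congr_ae (Filter.Eventually.of_forall fun r => smul_mul_assoc c _ _)

instance ConvAlg.instSMulCommClass : SMulCommClass 𝕂 (ConvAlg μ R hR) (ConvAlg μ R hR) where
  smul_comm c f g := CompactlySupportedContinuousMap.ext (α := G) (β := 𝕂) fun s => by
    refine Eq.symm (Eq.trans ?_ (integral_smul c _))
    exact integral_congr_ae (Filter.Eventually.of_forall fun r => mul_smul_comm c _ _)

/-- The integrated form as a representation of the convolution algebra. -/
def StrongContRep.integrateHom {X : BanachSp 𝕂} (U : StrongContRep G X) :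
    ConvAlg μ R hR →ₙₐ[𝕂] (X →L[𝕂] X) where
  toFun := fun f => U.integrate μ f
  map_smul' := fun c f => U.integrate_smul μ c f
  map_zero' := by
    have := U.integrate_smul μ (0 : 𝕂) (0 : C_c(G, 𝕂))
    rwa [zero_smul, zero_smul] at this
  map_add' := fun f g => U.integrate_add μ f g
  map_mul' := fun f g => U.integrate_groupConvolution μ f g

instance ConvAlg.instSeminormedAddCommGroup : SeminormedAddCommGroup (ConvAlg μ R hR) :=
  AddGroupSeminorm.toSeminormedAddCommGroup
    { toFun := fun f => classSeminorm μ R f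
      map_zero' := by
        refine le_antisymm (Real.iSup_le (fun U => ?_) le_rfl) (classSeminorm_nonneg μ R _)
        exact (norm_eq_zero.2 (map_zero (U.1.2.integrateHom μ R hR))).le
      add_le' := fun f g => Real.iSup_le (fun U => by
        rw [show U.1.2.integrate μ (f + g) = _ from map_add (U.1.2.integrateHom μ R hR) f g]
        exact (norm_add_le _ _).trans (add_le_add
          (norm_integrate_le_classSeminorm μ hR U.2 f)
          (norm_integrate_le_classSeminorm μ hR U.2 g)))
        (add_nonneg (classSeminorm_nonneg μ R f) (classSeminorm_nonneg μ R g))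
      neg' := fun f => by
        refine congrArg iSup (funext fun U => ?_)
        rw [show U.1.2.integrate μ (-f) = _ from map_neg (U.1.2.integrateHom μ R hR) f]
        exact norm_neg _ }

theorem ConvAlg.norm_def (f : ConvAlg μ R hR) : ‖f‖ = classSeminorm μ R f := rfl

instance ConvAlg.instNonUnitalSeminormedRing : NonUnitalSeminormedRing (ConvAlg μ R hR) where
  __ := ConvAlg.instSeminormedAddCommGroup μ R hR
  __ := ConvAlg.instNonUnitalRing μ R hR
  norm_mul_le f g := Real.iSup_le (fun U => by
    rw [show U.1.2.integrate μ (f * g) = _ from map_mul (U.1.2.integrateHom μ R hR) f g]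
    exact (norm_mul_le _ _).trans (mul_le_mul
      (norm_integrate_le_classSeminorm μ hR U.2 f)
      (norm_integrate_le_classSeminorm μ hR U.2 g) (norm_nonneg _) (norm_nonneg _)))
    (mul_nonneg (norm_nonneg f) (norm_nonneg g))

instance ConvAlg.instNormedSpace : NormedSpace 𝕂 (ConvAlg μ R hR) where
  norm_smul_le c f := Real.iSup_le (fun U => by
    rw [show U.1.2.integrate μ (c • f) = _ from map_smul (U.1.2.integrateHom μ R hR) c f,
      norm_smul]
    exact mul_le_mul_of_nonneg_left (norm_integrate_le_classSeminorm μ hR U.2 f) (norm_nonneg _))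
    (mul_nonneg (norm_nonneg c) (norm_nonneg f))

/-- The crossed product `(𝕂 ⋊_triv G)^R`: the (Hausdorff) completion of the convolution algebra
`C_c(G)` in the seminorm `σ`, i.e. the completion of `C_c(G) / ker σ`. -/
def CrossedProduct : Type _ := UniformSpace.Completion (ConvAlg μ R hR)

instance CrossedProduct.instNonUnitalNormedRing : NonUnitalNormedRing (CrossedProduct μ R hR) :=
  completionNonUnitalNormedRing (A := ConvAlg μ R hR)

instance CrossedProduct.instNormedSpace : NormedSpace 𝕂 (CrossedProduct μ R hR) :=
  inferInstanceAs (NormedSpace 𝕂 (UniformSpace.Completion (ConvAlg μ R hR)))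

instance CrossedProduct.instCompleteSpace : CompleteSpace (CrossedProduct μ R hR) :=
  inferInstanceAs (CompleteSpace (UniformSpace.Completion (ConvAlg μ R hR)))

instance CrossedProduct.instIsScalarTower :
    IsScalarTower 𝕂 (CrossedProduct μ R hR) (CrossedProduct μ R hR) :=
  ⟨fun c a b => completionMul_smul_left (A := ConvAlg μ R hR) c a b⟩

instance CrossedProduct.instSMulCommClass :
    SMulCommClass 𝕂 (CrossedProduct μ R hR) (CrossedProduct μ R hR) :=
  ⟨fun c a b => (completionMul_smul_right (A := ConvAlg μ R hR) c a b).symm⟩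

/-- The canonical homomorphism `q : C_c(G) → (𝕂 ⋊_triv G)^R`. -/
def CrossedProduct.q : ConvAlg μ R hR →ₙₐ[𝕂] CrossedProduct μ R hR where
  toFun := fun f => ((f : UniformSpace.Completion (ConvAlg μ R hR)))
  map_smul' := fun c f => UniformSpace.Completion.coe_smul c f
  map_zero' := UniformSpace.Completion.coe_zero
  map_add' := fun f g => UniformSpace.Completion.coe_add f g
  map_mul' := fun f g => (completionMul_coe f g).symm

theorem CrossedProduct.denseRange_q : DenseRange (CrossedProduct.q μ R hR) :=
  UniformSpace.Completion.denseRange_coe (α := ConvAlg μ R hR)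

theorem CrossedProduct.norm_q (f : ConvAlg μ R hR) :
    ‖CrossedProduct.q μ R hR f‖ = classSeminorm μ R f :=
  UniformSpace.Completion.norm_coe (E := ConvAlg μ R hR) f

variable {R}

/-- `U` is `R`-continuous if `‖U(f)‖ ≤ C σ(f)` for some constant `C`. -/
def StrongContRep.ContinuousFor (R : Set (SomeRep G 𝕂)) {X : BanachSp 𝕂}
    (U : StrongContRep G X) : Prop :=
  ∃ C : ℝ, ∀ f : C_c(G, 𝕂), ‖U.integrate μ f‖ ≤ C * classSeminorm μ R f

theorem continuousFor_of_mem (hR : UniformlyBoundedClass R) {U : SomeRep G 𝕂} (hU : U ∈ R) :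
    U.2.ContinuousFor μ R :=
  ⟨1, fun f => by rw [one_mul]; exact norm_integrate_le_classSeminorm μ hR hU f⟩

/-- The bounded operator `(𝕂 ⋊_triv G)^R → B(X)` extending `q(f) ↦ U(f)`. -/
def StrongContRep.inducedMap {X : BanachSp 𝕂} (U : StrongContRep G X) :
    CrossedProduct μ R hR →L[𝕂] (X →L[𝕂] X) :=
  LinearMap.extendOfNorm (U.integrateHom μ R hR : ConvAlg μ R hR →ₗ[𝕂] (X →L[𝕂] X))
    (CrossedProduct.q μ R hR : ConvAlg μ R hR →ₗ[𝕂] CrossedProduct μ R hR)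

theorem StrongContRep.inducedMap_q {X : BanachSp 𝕂} (U : StrongContRep G X)
    (hU : U.ContinuousFor μ R) (f : ConvAlg μ R hR) :
    U.inducedMap μ hR (CrossedProduct.q μ R hR f) = U.integrate μ f := by
  obtain ⟨C, hC⟩ := hU
  exact LinearMap.extendOfNorm_eq (CrossedProduct.denseRange_q μ R hR)
    ⟨C, fun f => by
      refine (hC f).trans_eq ?_
      rw [← CrossedProduct.norm_q μ R hR f]
      rfl⟩ f

/-- The representation `U^R` of `(𝕂 ⋊_triv G)^R` associated with an `R`-continuous `U`;
it is determined by `U^R(q(f)) = U(f)` for `f ∈ C_c(G)`. -/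
def StrongContRep.induced {X : BanachSp 𝕂} (U : StrongContRep G X)
    (hU : U.ContinuousFor μ R) : CrossedProduct μ R hR →ₙₐ[𝕂] (X →L[𝕂] X) where
  toFun := U.inducedMap μ hR
  map_smul' := fun c a => map_smul (U.inducedMap μ hR) c a
  map_zero' := map_zero _
  map_add' := fun a b => map_add _ a b
  map_mul' := fun a b => by
    refine (CrossedProduct.denseRange_q μ R hR).induction_on₂
      (p := fun a b => U.inducedMap μ hR (a * b) = U.inducedMap μ hR a * U.inducedMap μ hR b)
      (isClosed_eq (by fun_prop) (by fun_prop)) (fun f g => ?_) a b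
    rw [← map_mul, U.inducedMap_q μ hR hU, U.inducedMap_q μ hR hU, U.inducedMap_q μ hR hU]
    exact map_mul (U.integrateHom μ R hR) f g

theorem StrongContRep.induced_q {X : BanachSp 𝕂} (U : StrongContRep G X)
    (hU : U.ContinuousFor μ R) (f : ConvAlg μ R hR) :
    U.induced μ hR hU (CrossedProduct.q μ R hR f) = U.integrate μ f :=
  U.inducedMap_q μ hR hU f

end Algebra

/-! ### Properties of representations -/

section Representations

variable {𝕂 : Type*} [RCLike 𝕂] {X Y : BanachSp 𝕂}

/-- A representation of an algebra on `X` is non-degenerate if the vectors `T(a)x` span a dense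
subspace of `X`. -/
def IsNondegenerateRep {B : Type*} [NonUnitalNormedRing B] [NormedSpace 𝕂 B]
    (T : B →ₙₐ[𝕂] (X →L[𝕂] X)) : Prop :=
  Dense (Submodule.span 𝕂 {y : X | ∃ (a : B) (x : X), y = T a x} : Set X)

/-- A representation of a normed algebra is contractive if it has norm at most one. -/
def IsContractiveRep {B : Type*} [NonUnitalNormedRing B] [NormedSpace 𝕂 B]
    (T : B →ₙₐ[𝕂] (X →L[𝕂] X)) : Prop :=
  ∀ a : B, ‖T a‖ ≤ ‖a‖

/-- A subspace is invariant under a family of operators. -/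
def IsInvariantUnder {ι : Type*} (S : ι → (X →L[𝕂] X)) (Z : Submodule 𝕂 X) : Prop :=
  ∀ i, ∀ x ∈ Z, S i x ∈ Z

/-- A bounded operator intertwines two families of operators. -/
def Intertwines {ι : Type*} (S : ι → (X →L[𝕂] X)) (T : ι → (Y →L[𝕂] Y)) (Φ : X →L[𝕂] Y) :
    Prop :=
  ∀ i, (T i).comp Φ = Φ.comp (S i)

/-- A Hilbert space structure on the Banach space `X`: an inner product inducing its norm.
(There is at most one.) -/
structure HilbertStructure (X : BanachSp 𝕂) where
  innerProductSpace : InnerProductSpace 𝕂 X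
  compatible : innerProductSpace.toNormedSpace = X.normedSpace

/-- The inner product, conjugate-linear in the first variable. -/
def HilbertStructure.ip (H : HilbertStructure X) (x y : X) : 𝕂 :=
  H.innerProductSpace.inner x y

/-- `U` is a unitary representation: `X` is a Hilbert space, and the (invertible) operators `U_r`
preserve its inner product. -/
def IsUnitaryRep {G : Type*} [Group G] [TopologicalSpace G] (U : StrongContRep G X) : Prop :=
  ∃ H : HilbertStructure X, ∀ (r : G) (x y : X), H.ip (U.op r x) (U.op r y) = H.ip x y

/-- `T` is an involutive representation: `X` is a Hilbert space, and `T(a*)` is the adjoint of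
`T(a)`. -/
def IsInvolutiveRep {B : Type*} [NonUnitalNormedRing B] [NormedSpace 𝕂 B] [Star B]
    (T : B →ₙₐ[𝕂] (X →L[𝕂] X)) : Prop :=
  ∃ H : HilbertStructure X, ∀ (a : B) (x y : X), H.ip (T a x) y = H.ip x (T (star a) y)

end Representations

/-! ### The two classes of representations and the map between them -/

/-- Representations of the algebra `B` on arbitrary Banach spaces (together with the space). -/
abbrev SomeAlgRep.{u, w, v} {𝕂 : Type w} [RCLike 𝕂] (B : Type u) [NonUnitalNormedRing B]
    [NormedSpace 𝕂 B] : Type (max u w (v + 1)) :=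
  Σ X : BanachSp.{w, v} 𝕂, B →ₙₐ[𝕂] (X →L[𝕂] X)

/-- The class of all strongly continuous representations `U` of `G` in spaces from `𝓧` with
`‖U_r‖ ≤ ν(r)` for all `r`. -/
def boundedReps {G : Type*} [Group G] [TopologicalSpace G] {𝕂 : Type*} [RCLike 𝕂]
    (𝓧 : Set (BanachSp 𝕂)) (ν : G → ℝ≥0) : Set (SomeRep G 𝕂) :=
  {U | U.1 ∈ 𝓧 ∧ ∀ r : G, ‖U.2.op r‖ ≤ ν r}

/-- The class of all non-degenerate contractive representations of `B` in spaces from `𝓧`. -/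
def nondegContractiveReps {𝕂 : Type*} [RCLike 𝕂] (B : Type*) [NonUnitalNormedRing B]
    [NormedSpace 𝕂 B] (𝓧 : Set (BanachSp 𝕂)) : Set (SomeAlgRep (𝕂 := 𝕂) B) :=
  {T | T.1 ∈ 𝓧 ∧ IsNondegenerateRep T.2 ∧ IsContractiveRep T.2}

/-- The assignment `U ↦ U^R`, for `U ∈ R`. -/
def inducedRep {G : Type*} [Group G] [TopologicalSpace G] [IsTopologicalGroup G]
    [LocallyCompactSpace G] [MeasurableSpace G] [BorelSpace G] {𝕂 : Type*} [RCLike 𝕂]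
    (μ : Measure G) [μ.IsHaarMeasure] {R : Set (SomeRep G 𝕂)} (hR : UniformlyBoundedClass R)
    (U : SomeRep G 𝕂) (hU : U ∈ R) : SomeAlgRep (𝕂 := 𝕂) (CrossedProduct μ R hR) :=
  ⟨U.1, U.2.induced μ hR (continuousFor_of_mem μ hR hU)⟩

/-! ### The involution on `C_c(G)` -/

section Involution

variable {G : Type*} [Group G] [TopologicalSpace G] [IsTopologicalGroup G] [LocallyCompactSpace G]

/-- The modular function `Δ`, normalised by `Δ(r) ∫ f(s r) ds = ∫ f(s) ds`; it is the inverse of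
the modular character of Mathlib. -/
def modularFunction (r : G) : ℝ≥0 := Measure.modularCharacter r⁻¹

theorem modularFunction_integral [MeasurableSpace G] [BorelSpace G] (μ : Measure G)
    [μ.IsHaarMeasure] (f : C_c(G, ℝ)) (r : G) :
    (modularFunction r : ℝ) * ∫ s, f (s * r) ∂μ = ∫ s, f s ∂μ := by
  have h := Measure.integral_isMulLeftInvariant_eq_smul_of_hasCompactSupport
    (Measure.map (· * r) μ) μ (map_continuous f) f.hasCompactSupport
  rw [integral_map (by fun_prop) (map_continuous f).aestronglyMeasurable,
    ← Measure.modularCharacterFun_eq_haarScalarFactor μ r, integral_smul_nnreal_measure] at h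
  have h1 : (modularFunction r : ℝ≥0) * Measure.modularCharacterFun r = 1 := by
    change Measure.modularCharacter r⁻¹ * Measure.modularCharacter r = 1
    rw [← map_mul, inv_mul_cancel, map_one]
  rw [h, NNReal.smul_def, smul_eq_mul, ← mul_assoc]
  have h2 : (modularFunction r : ℝ) * (Measure.modularCharacterFun r : ℝ) = 1 := by
    exact_mod_cast h1
  rw [h2, one_mul]

theorem continuous_modularCharacterFun :
    Continuous fun r : G => ((Measure.modularCharacterFun r : ℝ≥0) : ℝ) := by
  borelize G
  obtain ⟨⟨f, f_cont⟩, f_comp, f_nonneg, f_one⟩ :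
    ∃ f : C(G, ℝ), HasCompactSupport f ∧ 0 ≤ f ∧ f 1 ≠ 0 := exists_continuous_nonneg_pos 1
  let μ : Measure G := Measure.haar
  have hne : ∫ x, f x ∂μ ≠ 0 :=
    (f_cont.integral_pos_of_hasCompactSupport_nonneg_nonzero f_comp f_nonneg f_one).ne'
  have key : ∀ r : G, ((Measure.modularCharacterFun r : ℝ≥0) : ℝ) =
      (∫ x, f (x * r) ∂μ) / ∫ x, f x ∂μ := fun r => by
    rw [Measure.modularCharacterFun_eq_haarScalarFactor μ r,
      Measure.haarScalarFactor_eq_integral_div _ _ f_cont f_comp hne,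
      integral_map (by fun_prop) f_cont.aestronglyMeasurable]
  simp_rw [key]
  refine Continuous.div_const (continuous_iff_continuousAt.2 fun r₀ => ?_) _
  obtain ⟨t, t_comp, ht⟩ : ∃ t, IsCompact t ∧ t ∈ 𝓝 r₀ := exists_compact_mem_nhds r₀
  have hA : ContinuousOn (fun r : G => ∫ x, f (x * r) ∂μ) t := by
    apply continuousOn_integral_of_compact_support
      (f_comp.isCompact.mul t_comp.inv)
    · exact (f_cont.comp (continuous_snd.mul continuous_fst)).continuousOn
    · intro r x hr hx
      contrapose! hx
      exact ⟨x * r, subset_tsupport _ hx, r⁻¹, Set.inv_mem_inv.2 hr, by simp⟩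
  exact hA.continuousAt ht

/-- The involution `f*(s) = Δ(s⁻¹) conj(f(s⁻¹))` on `C_c(G)`. -/
def groupInvolution {𝕂 : Type*} [RCLike 𝕂] (f : C_c(G, 𝕂)) : C_c(G, 𝕂) where
  toFun := fun s => ((modularFunction s⁻¹ : ℝ) : 𝕂) * (starRingEnd 𝕂) (f s⁻¹)
  continuous_toFun := by
    have h : Continuous fun s : G => ((modularFunction s⁻¹ : ℝ≥0) : ℝ) := by
      have h' := continuous_modularCharacterFun (G := G)
      have : (fun s : G => ((modularFunction s⁻¹ : ℝ≥0) : ℝ)) =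
          fun s => ((Measure.modularCharacterFun s : ℝ≥0) : ℝ) := by
        funext s
        simp [modularFunction, Measure.modularCharacter]
      rwa [this]
    exact (RCLike.continuous_ofReal.comp h).mul
      (RCLike.continuous_conj.comp ((map_continuous f).comp continuous_inv))
  hasCompactSupport' := by
    refine HasCompactSupport.mul_left ?_
    refine HasCompactSupport.comp_left (g := starRingEnd 𝕂) ?_ (map_zero _)
    exact f.hasCompactSupport.comp_homeomorph (Homeomorph.inv G)

end Involution

end

universe u w v

/-! The integrated form `U(u)` tends strongly to the identity when `u` runs through normalised bump
functions concentrating at `e`, so `U` and `f ↦ U(f)` have the same closed invariant subspaces and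
the same intertwiners. Left translation of functions induces a strongly continuous representation
`λ` of `G` on the crossed product `A`, and `λ(f)` is left multiplication by `q(f)`. A non-degenerate
contractive representation `T` of `A` is disintegrated by `U_r T(a)x = T(λ_r a)x`: this is well
defined with `‖U_r‖ ≤ ν(r)` because `U_r T(a)x` is the limit of `T(λ_r q(u)) T(a)x`, where
`‖λ_r‖ ≤ ν(r)` and `limsup ‖q(u)‖ ≤ 1`, the latter because `limsup ν(r) ≤ 1` as `r → e`.
In the Hilbert space case `U(f*)` is the adjoint of `U(f)` by the inversion formula for Haar
measure, and conversely `(λ_r a)* (λ_r b) = a* b` makes `U_r` isometric. -/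

noncomputable section

open Filter
open scoped Pointwise

section Integration

variable {G : Type*} [TopologicalSpace G] [MeasurableSpace G] [BorelSpace G]
  {𝕂 : Type*} [RCLike 𝕂] {E : Type*} [NormedAddCommGroup E] [NormedSpace 𝕂 E]

theorem integrable_norm_compactlySupported (μ : Measure G) [IsFiniteMeasureOnCompacts μ]
    (f : C_c(G, 𝕂)) : Integrable (fun s => ‖f s‖) μ :=
  ((map_continuous f).integrable_of_hasCompactSupport f.hasCompactSupport).norm

theorem integrable_smul_compactlySupported (μ : Measure G) [IsFiniteMeasureOnCompacts μ]
    (f : C_c(G, 𝕂)) {φ : G → E} (hφ : Continuous φ) : Integrable (fun s => f s • φ s) μ :=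
  ((map_continuous f).smul hφ).integrable_of_hasCompactSupport f.hasCompactSupport.smul_right

theorem norm_integral_smul_le [NormedSpace ℝ E] (μ : Measure G) [IsFiniteMeasureOnCompacts μ]
    (f : C_c(G, 𝕂)) {φ : G → E} {ε : ℝ} (hφ : ∀ s ∈ tsupport f, ‖φ s‖ ≤ ε) :
    ‖∫ s, f s • φ s ∂μ‖ ≤ ε * ∫ s, ‖f s‖ ∂μ := by
  rw [← integral_const_mul]
  refine norm_integral_le_of_norm_le ((integrable_norm_compactlySupported μ f).const_mul ε)
    (.of_forall fun s => ?_)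
  by_cases hs : s ∈ tsupport f
  · rw [norm_smul, mul_comm]
    gcongr
    exact hφ s hs
  · simp [image_eq_zero_of_notMem_tsupport hs]

end Integration

section ApproximateUnit

variable {G : Type*} [Group G] [TopologicalSpace G] [MeasurableSpace G] {𝕂 : Type*} [RCLike 𝕂]

/-- The filter on `C_c(G)` generated by the functions of integral and `L¹`-norm one whose support
lies in a given neighbourhood of the identity: the approximate unit of the convolution algebra,
encoded as a filter instead of a net. -/
def approxUnit (𝕂 : Type*) [RCLike 𝕂] (μ : Measure G) : Filter C_c(G, 𝕂) :=
  comap (fun u => tsupport u) (𝓝 (1 : G)).smallSets ⊓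
    𝓟 {u | ∫ s, ‖u s‖ ∂μ = 1 ∧ ∫ s, u s ∂μ = 1}

theorem eventually_approxUnit {μ : Measure G} {p : G → Prop} (hp : ∀ᶠ s in 𝓝 1, p s) :
    ∀ᶠ u : C_c(G, 𝕂) in approxUnit 𝕂 μ, ∀ s ∈ tsupport u, p s :=
  ((eventually_smallSets_forall.2 hp).comap _).filter_mono inf_le_left

theorem eventually_approxUnit_integral_eq_one {μ : Measure G} :
    ∀ᶠ u : C_c(G, 𝕂) in approxUnit 𝕂 μ, ∫ s, ‖u s‖ ∂μ = 1 ∧ ∫ s, u s ∂μ = 1 :=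
  (eventually_principal.2 fun _ hu => hu).filter_mono inf_le_right

variable [BorelSpace G]

theorem exists_normalized_bump [IsTopologicalGroup G] [LocallyCompactSpace G] (𝕂 : Type*)
    [RCLike 𝕂] (μ : Measure G) [μ.IsHaarMeasure] {V : Set G} (hV : V ∈ 𝓝 (1 : G)) :
    ∃ u : C_c(G, 𝕂), tsupport u ⊆ V ∧ ∫ s, ‖u s‖ ∂μ = 1 ∧ ∫ s, u s ∂μ = 1 := by
  obtain ⟨f, hf1, hfc, hfV, hf01⟩ := exists_continuousMap_one_of_isCompact_subset_isOpen
    (isCompact_singleton (x := (1 : G))) isOpen_interior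
    (Set.singleton_subset_iff.2 (mem_interior_iff_mem_nhds.2 hV))
  have hpos : 0 < ∫ s, f s ∂μ :=
    f.continuous.integral_pos_of_hasCompactSupport_nonneg_nonzero hfc (fun s => (hf01 s).1)
      (x := 1) (by simp [hf1 rfl])
  set c : ℝ := (∫ s, f s ∂μ)⁻¹
  let u : C_c(G, 𝕂) :=
    { toFun := fun s => ((c * f s : ℝ) : 𝕂)
      continuous_toFun := by fun_prop
      hasCompactSupport' :=
        HasCompactSupport.comp_left (g := fun t : ℝ => ((c * t : ℝ) : 𝕂)) hfc (by simp) }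
  have hu : ∀ s, u s = ((c * f s : ℝ) : 𝕂) := fun s => rfl
  have hu_norm : ∀ s, ‖u s‖ = c * f s := fun s => by
    rw [hu, RCLike.norm_ofReal, abs_of_nonneg (mul_nonneg (inv_pos.2 hpos).le (hf01 s).1)]
  have hcf : ∫ s, c * f s ∂μ = 1 := by rw [integral_const_mul, inv_mul_cancel₀ hpos.ne']
  refine ⟨u, (closure_mono ?_).trans (hfV.trans interior_subset), ?_, ?_⟩
  · exact Function.support_subset_iff'.2 fun s hs => by simp [hu, Function.notMem_support.1 hs]
  · simp_rw [hu_norm, hcf]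
  · simp only [hu, integral_ofReal, hcf, RCLike.ofReal_one]

instance approxUnit_neBot [IsTopologicalGroup G] [LocallyCompactSpace G] (μ : Measure G)
    [μ.IsHaarMeasure] :
    (approxUnit 𝕂 μ).NeBot := by
  refine ((((𝓝 (1 : G)).basis_sets.smallSets.comap _).inf_principal _).neBot_iff).2 fun hV => ?_
  obtain ⟨u, hu⟩ := exists_normalized_bump 𝕂 μ hV
  exact ⟨u, hu⟩

theorem tendsto_integral_smul_approxUnit {E : Type*} [NormedAddCommGroup E] [NormedSpace ℝ E]
    [NormedSpace 𝕂 E] [IsScalarTower ℝ 𝕂 E] [CompleteSpace E] (μ : Measure G)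
    [IsFiniteMeasureOnCompacts μ] {φ : G → E} (hφ : Continuous φ) :
    Tendsto (fun u : C_c(G, 𝕂) => ∫ s, u s • φ s ∂μ) (approxUnit 𝕂 μ) (𝓝 (φ 1)) := by
  refine Metric.nhds_basis_closedBall.tendsto_right_iff.2 fun ε hε => ?_
  have hnear : ∀ᶠ s in 𝓝 1, ‖φ s - φ 1‖ ≤ ε := by
    simpa only [Metric.mem_closedBall, dist_eq_norm] using
      hφ.continuousAt.eventually (Metric.closedBall_mem_nhds (φ 1) hε)
  filter_upwards [eventually_approxUnit hnear, eventually_approxUnit_integral_eq_one]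
    with u hu ⟨hu_norm, hu_int⟩
  have hsub : ∫ s, u s • φ s ∂μ - φ 1 = ∫ s, u s • (φ s - φ 1) ∂μ := by
    simp only [smul_sub]
    rw [integral_sub (integrable_smul_compactlySupported μ u hφ)
      (integrable_smul_compactlySupported μ u continuous_const), integral_smul_const, hu_int,
      one_smul]
  rw [Metric.mem_closedBall, dist_eq_norm, hsub]
  simpa only [hu_norm, mul_one] using norm_integral_smul_le μ u hu

theorem StrongContRep.op_one {G : Type*} [Group G] [TopologicalSpace G] {X : BanachSp 𝕂}
    (U : StrongContRep G X) : U.op 1 = 1 := by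
  simp only [StrongContRep.op, map_one, Units.val_one]

theorem StrongContRep.tendsto_integrate_approxUnit [IsTopologicalGroup G] (μ : Measure G)
    [IsFiniteMeasureOnCompacts μ] {X : BanachSp 𝕂} (U : StrongContRep G X) (x : X) :
    Tendsto (fun u => U.integrate μ u x) (approxUnit 𝕂 μ) (𝓝 x) := by
  have h := tendsto_integral_smul_approxUnit (𝕂 := 𝕂) μ (U.continuous_op x)
  rwa [U.op_one] at h

end ApproximateUnit

section LeftTranslation

variable {G : Type*} [Group G] [TopologicalSpace G] [IsTopologicalGroup G]
  {𝕂 : Type*} [RCLike 𝕂]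

/-- Left translation on `C_c(G)`, `(λ_r f)(s) = f (r⁻¹ s)`, as a representation of `G`. -/
def leftTranslate : Representation 𝕂 G C_c(G, 𝕂) where
  toFun r :=
    { toFun := fun f =>
        { toFun := fun s => f (r⁻¹ * s)
          continuous_toFun := (map_continuous f).comp (continuous_const.mul continuous_id)
          hasCompactSupport' := f.hasCompactSupport.comp_homeomorph (Homeomorph.mulLeft r⁻¹) }
      map_add' := fun _ _ => rfl
      map_smul' := fun _ _ => rfl }
  map_one' := by
    ext f s
    exact congrArg f (by rw [inv_one, one_mul])
  map_mul' r t := by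
    ext f s
    exact congrArg f (by rw [mul_inv_rev, mul_assoc])

theorem leftTranslate_apply (r s : G) (f : C_c(G, 𝕂)) : leftTranslate r f s = f (r⁻¹ * s) := rfl

theorem leftTranslate_apply_eq_zero {K : Set G} {f : C_c(G, 𝕂)} {r s : G} (hr : r ∈ K)
    (hs : s ∉ K * tsupport f) : leftTranslate r f s = 0 :=
  image_eq_zero_of_notMem_tsupport (f := f) fun h => hs ⟨r, hr, r⁻¹ * s, h, mul_inv_cancel_left r s⟩

theorem tsupport_leftTranslate_sub_subset {K : Set G} (hK : IsCompact K) {r t : G} (hr : r ∈ K)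
    (ht : t ∈ K) (f : C_c(G, 𝕂)) :
    tsupport (leftTranslate r f - leftTranslate t f) ⊆ K * tsupport f :=
  closure_minimal (Function.support_subset_iff'.2 fun s hs => by
    simp [leftTranslate_apply_eq_zero hr hs, leftTranslate_apply_eq_zero ht hs])
    ((isClosed_tsupport f).mul_left_of_isCompact hK)

theorem tendsto_integral_norm_leftTranslate_sub [LocallyCompactSpace G] [MeasurableSpace G]
    [BorelSpace G] (μ : Measure G) [IsFiniteMeasureOnCompacts μ] (f : C_c(G, 𝕂)) (r₀ : G) :
    Tendsto (fun r => ∫ s, ‖(leftTranslate r f - leftTranslate r₀ f) s‖ ∂μ) (𝓝 r₀) (𝓝 0) := by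
  obtain ⟨K, hK, hKr⟩ := exists_compact_mem_nhds r₀
  have hcont : ContinuousOn
      (fun r => ∫ s, ‖(leftTranslate r f - leftTranslate r₀ f) s‖ ∂μ) K := by
    refine continuousOn_integral_of_compact_support (k := K * tsupport f)
      (hK.mul f.hasCompactSupport.isCompact) ?_ fun r s hr hs => ?_
    · refine Continuous.continuousOn (Continuous.norm ?_)
      exact ((map_continuous f).comp (continuous_fst.inv.mul continuous_snd)).sub
        ((map_continuous f).comp (continuous_const.mul continuous_snd))
    · simp [leftTranslate_apply_eq_zero hr hs,
        leftTranslate_apply_eq_zero (mem_of_mem_nhds hKr) hs]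
  simpa using (hcont.continuousAt hKr).tendsto

theorem StrongContRep.integrate_leftTranslate [MeasurableSpace G] [BorelSpace G]
    {X : BanachSp 𝕂} (μ : Measure G) [μ.IsMulLeftInvariant] [IsFiniteMeasureOnCompacts μ]
    (U : StrongContRep G X) (r : G) (f : C_c(G, 𝕂)) (x : X) :
    U.integrate μ (leftTranslate r f) x = U.op r (U.integrate μ f x) := by
  rw [U.integrate_apply μ (leftTranslate r f), U.integrate_apply μ f,
    ← ContinuousLinearMap.integral_comp_comm _ (U.integrable μ f x),
    ← integral_mul_left_eq_self _ r]
  simp [leftTranslate_apply, U.op_mul]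

end LeftTranslation

section IntegratedForm

variable {G : Type*} [Group G] [TopologicalSpace G] [IsTopologicalGroup G]
  [MeasurableSpace G] [BorelSpace G] {𝕂 : Type*} [RCLike 𝕂] {X Y : BanachSp 𝕂}
  {U : StrongContRep G X} {V : StrongContRep G Y} (μ : Measure G)

theorem Intertwines.integrate [IsFiniteMeasureOnCompacts μ] {Φ : X →L[𝕂] Y}
    (h : Intertwines U.op V.op Φ) : Intertwines (U.integrate μ) (V.integrate μ) Φ := by
  intro f
  ext x
  change ∫ s, f s • V.op s (Φ x) ∂μ = Φ (∫ s, f s • U.op s x ∂μ)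
  rw [← Φ.integral_comp_comm (U.integrable μ f x)]
  refine integral_congr_ae (.of_forall fun s => ?_)
  exact (congrArg (f s • ·) (DFunLike.congr_fun (h s) x)).trans (map_smul Φ (f s) _).symm

theorem intertwines_integrate_iff [LocallyCompactSpace G] [μ.IsHaarMeasure] {Φ : X →L[𝕂] Y} :
    Intertwines (U.integrate μ) (V.integrate μ) Φ ↔ Intertwines U.op V.op Φ := by
  refine ⟨fun h r => ContinuousLinearMap.ext fun x => ?_, fun h => h.integrate μ⟩
  have happly (f : C_c(G, 𝕂)) (x : X) : V.integrate μ f (Φ x) = Φ (U.integrate μ f x) :=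
    DFunLike.congr_fun (h f) x
  have htranslate (u : C_c(G, 𝕂)) :
      V.op r (V.integrate μ u (Φ x)) = Φ (U.op r (U.integrate μ u x)) := by
    rw [← V.integrate_leftTranslate μ, ← U.integrate_leftTranslate μ, happly]
  exact tendsto_nhds_unique
    (((V.op r).continuous.tendsto _).comp (V.tendsto_integrate_approxUnit μ (Φ x)))
    ((((Φ.comp (U.op r)).continuous.tendsto _).comp (U.tendsto_integrate_approxUnit μ x)).congr
      fun u => (htranslate u).symm)

theorem IsInvariantUnder.integrate [IsFiniteMeasureOnCompacts μ] {Z : Submodule 𝕂 X}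
    (hZ : IsClosed (Z : Set X)) (h : IsInvariantUnder U.op Z) :
    IsInvariantUnder (U.integrate μ) Z := by
  intro f x hx
  have : CompleteSpace Z := hZ.completeSpace_coe
  have hcoe := Z.subtypeₗᵢ.integral_comp_comm (μ := μ)
    fun s => (⟨f s • U.op s x, Z.smul_mem _ (h s x hx)⟩ : Z)
  rw [U.integrate_apply μ]
  exact hcoe ▸ Subtype.property _

theorem isInvariantUnder_integrate_iff [LocallyCompactSpace G] [μ.IsHaarMeasure]
    {Z : Submodule 𝕂 X} (hZ : IsClosed (Z : Set X)) :
    IsInvariantUnder (U.integrate μ) Z ↔ IsInvariantUnder U.op Z := by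
  refine ⟨fun h r x hx => ?_, fun h => h.integrate μ hZ⟩
  refine hZ.mem_of_tendsto
    (((U.op r).continuous.tendsto _).comp (U.tendsto_integrate_approxUnit μ x))
    (.of_forall fun u => ?_)
  rw [Function.comp_apply, ← U.integrate_leftTranslate μ]
  exact h _ x hx

theorem StrongContRep.ext_op {G : Type*} [Group G] [TopologicalSpace G] {U V : StrongContRep G X}
    (h : ∀ r, U.op r = V.op r) : U = V := by
  cases U
  cases V
  congr 1
  ext r : 2
  exact h r

end IntegratedForm

section CrossedProduct

variable {G : Type*} [Group G] [TopologicalSpace G] [IsTopologicalGroup G] [LocallyCompactSpace G]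
  [MeasurableSpace G] [BorelSpace G] {𝕂 : Type*} [RCLike 𝕂] {X Y : BanachSp 𝕂}
  {U : StrongContRep G X} {V : StrongContRep G Y}
  (μ : Measure G) [μ.IsHaarMeasure] {R : Set (SomeRep G 𝕂)} (hR : UniformlyBoundedClass R)

/-- The canonical map `q` from `C_c(G)` to the crossed product as a linear map, defined on `C_c(G)`
itself instead of its copy `ConvAlg μ R hR`. -/
def CrossedProduct.ofCc : C_c(G, 𝕂) →ₗ[𝕂] CrossedProduct μ R hR where
  toFun := fun f => CrossedProduct.q μ R hR f
  map_add' := map_add (CrossedProduct.q μ R hR)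
  map_smul' := map_smul (CrossedProduct.q μ R hR)

theorem CrossedProduct.denseRange_ofCc : DenseRange (CrossedProduct.ofCc μ hR) :=
  CrossedProduct.denseRange_q μ R hR

theorem CrossedProduct.norm_ofCc (f : C_c(G, 𝕂)) :
    ‖CrossedProduct.ofCc μ hR f‖ = classSeminorm μ R f :=
  CrossedProduct.norm_q μ R hR f

theorem StrongContRep.inducedMap_ofCc (hU : U.ContinuousFor μ R) (f : C_c(G, 𝕂)) :
    U.inducedMap μ hR (CrossedProduct.ofCc μ hR f) = U.integrate μ f :=
  U.inducedMap_q μ hR hU f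

theorem StrongContRep.induced_ofCc (hU : U.ContinuousFor μ R) (f : C_c(G, 𝕂)) :
    U.induced μ hR hU (CrossedProduct.ofCc μ hR f) = U.integrate μ f :=
  U.induced_q μ hR hU f

theorem StrongContRep.inducedMap_mul (hU : U.ContinuousFor μ R) (a b : CrossedProduct μ R hR) :
    U.inducedMap μ hR (a * b) = U.inducedMap μ hR a * U.inducedMap μ hR b :=
  map_mul (U.induced μ hR hU) a b

theorem intertwines_induced_iff (hU : U.ContinuousFor μ R) (hV : V.ContinuousFor μ R)
    {Φ : X →L[𝕂] Y} :
    Intertwines (U.induced μ hR hU) (V.induced μ hR hV) Φ ↔ Intertwines U.op V.op Φ := by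
  refine Iff.trans ⟨fun h f => ?_, fun h a => ?_⟩ (intertwines_integrate_iff μ)
  · rw [← U.induced_ofCc μ hR hU, ← V.induced_ofCc μ hR hV, h]
  · refine (CrossedProduct.denseRange_ofCc μ hR).induction_on
      (p := fun a => (V.inducedMap μ hR a).comp Φ = Φ.comp (U.inducedMap μ hR a)) a
      (isClosed_eq (by fun_prop) (by fun_prop)) fun f => ?_
    rw [U.inducedMap_ofCc μ hR hU, V.inducedMap_ofCc μ hR hV, h f]

theorem isInvariantUnder_induced_iff (hU : U.ContinuousFor μ R) {Z : Submodule 𝕂 X}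
    (hZ : IsClosed (Z : Set X)) :
    IsInvariantUnder (U.induced μ hR hU) Z ↔ IsInvariantUnder U.op Z := by
  refine Iff.trans ⟨fun h f x hx => ?_, fun h a x hx => ?_⟩ (isInvariantUnder_integrate_iff μ hZ)
  · rw [← U.induced_ofCc μ hR hU]
    exact h _ x hx
  · refine (CrossedProduct.denseRange_ofCc μ hR).induction_on
      (p := fun a => U.inducedMap μ hR a x ∈ Z) a (hZ.preimage (by fun_prop)) fun f => ?_
    rw [U.inducedMap_ofCc μ hR hU]
    exact h f x hx

theorem StrongContRep.eq_of_induced_eq {U V : StrongContRep G X} (hU : U.ContinuousFor μ R)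
    (hV : V.ContinuousFor μ R) (h : U.induced μ hR hU = V.induced μ hR hV) : U = V := by
  refine StrongContRep.ext_op fun r => ?_
  have hid := (intertwines_induced_iff μ hR hU hV (Φ := .id 𝕂 X)).1 fun a => by
    rw [h, ContinuousLinearMap.comp_id, ContinuousLinearMap.id_comp]
  simpa using (hid r).symm

theorem StrongContRep.isNondegenerateRep_induced (hU : U.ContinuousFor μ R) :
    IsNondegenerateRep (U.induced μ hR hU) := fun x =>
  mem_closure_of_tendsto (U.tendsto_integrate_approxUnit μ x) (.of_forall fun f =>
    Submodule.subset_span ⟨CrossedProduct.ofCc μ hR f, x, by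
      rw [U.induced_ofCc μ hR hU]⟩)

theorem norm_inducedMap_le {U : SomeRep G 𝕂} (hU : U ∈ R) (a : CrossedProduct μ R hR) :
    ‖U.2.inducedMap μ hR a‖ ≤ ‖a‖ := by
  rw [← one_mul ‖a‖]
  refine LinearMap.norm_extendOfNorm_apply_le (CrossedProduct.denseRange_q μ R hR) 1 (fun f => ?_) a
  rw [one_mul]
  exact (norm_integrate_le_classSeminorm μ hR hU f).trans_eq (CrossedProduct.norm_q μ R hR f).symm

theorem CrossedProduct.norm_le {a : CrossedProduct μ R hR} {c : ℝ} (hc : 0 ≤ c)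
    (h : ∀ U ∈ R, ‖U.2.inducedMap μ hR a‖ ≤ c) : ‖a‖ ≤ c := by
  refine le_of_forall_pos_le_add fun ε hε => ?_
  obtain ⟨f, hf⟩ := (CrossedProduct.denseRange_ofCc μ hR).exists_dist_lt a (half_pos hε)
  rw [dist_eq_norm] at hf
  have hfc : ‖CrossedProduct.ofCc μ hR f‖ ≤ c + ε / 2 := by
    rw [CrossedProduct.norm_ofCc]
    refine Real.iSup_le (fun ⟨U, hU⟩ => ?_) (by positivity)
    rw [← U.2.inducedMap_ofCc μ hR (continuousFor_of_mem μ hR hU)]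
    refine (norm_le_norm_add_norm_sub _ _).trans (add_le_add (h U hU) ?_)
    rw [← map_sub]
    exact (norm_inducedMap_le μ hR hU _).trans hf.le
  linarith [norm_le_norm_add_norm_sub' a (CrossedProduct.ofCc μ hR f)]

theorem CrossedProduct.eq_of_inducedMap_eq {a b : CrossedProduct μ R hR}
    (h : ∀ U ∈ R, U.2.inducedMap μ hR a = U.2.inducedMap μ hR b) : a = b := by
  refine sub_eq_zero.1 (norm_le_zero_iff.1 (CrossedProduct.norm_le μ hR le_rfl fun U hU => ?_))
  rw [map_sub, h U hU, sub_self, norm_zero]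

theorem CrossedProduct.norm_ofCc_le {f : C_c(G, 𝕂)} {M : ℝ} (hM : 0 ≤ M)
    (h : ∀ U ∈ R, ∀ s ∈ tsupport f, ‖U.2.op s‖ ≤ M) :
    ‖CrossedProduct.ofCc μ hR f‖ ≤ M * ∫ s, ‖f s‖ ∂μ := by
  rw [CrossedProduct.norm_ofCc]
  exact Real.iSup_le (fun U => U.1.2.norm_integrate_le μ f hM (h U.1 U.2))
    (mul_nonneg hM (integral_nonneg fun _ => norm_nonneg _))

theorem CrossedProduct.eventually_norm_ofCc_le {M : ℝ} (hM : 0 ≤ M)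
    (h : ∀ᶠ s in 𝓝 1, ∀ U ∈ R, ‖U.2.op s‖ ≤ M) :
    ∀ᶠ u in approxUnit 𝕂 μ, ‖CrossedProduct.ofCc μ hR u‖ ≤ M := by
  filter_upwards [eventually_approxUnit h, eventually_approxUnit_integral_eq_one]
    with u hu ⟨hu_norm, _⟩
  simpa only [hu_norm, mul_one] using
    CrossedProduct.norm_ofCc_le μ hR hM fun U hU s hs => hu s hs U hU

theorem UniformlyBoundedClass.exists_bound {G : Type*} [Group G] [TopologicalSpace G]
    {R : Set (SomeRep G 𝕂)} (hR : UniformlyBoundedClass R) {K : Set G} (hK : IsCompact K) :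
    ∃ M : ℝ, 0 ≤ M ∧ ∀ U ∈ R, ∀ r ∈ K, ‖U.2.op r‖ ≤ M := by
  obtain ⟨ν, hν, hRν⟩ := hR
  obtain ⟨M, hM⟩ := hν K hK
  exact ⟨M, M.2, fun U hU r hr => (hRν U hU r).trans (hM (Set.mem_image_of_mem ν hr))⟩

theorem CrossedProduct.norm_ofCc_leftTranslate_le {r : G} {M : ℝ} (hM : 0 ≤ M)
    (h : ∀ U ∈ R, ‖U.2.op r‖ ≤ M) (f : C_c(G, 𝕂)) :
    ‖CrossedProduct.ofCc μ hR (leftTranslate r f)‖ ≤ M * ‖CrossedProduct.ofCc μ hR f‖ := by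
  simp only [CrossedProduct.norm_ofCc]
  refine Real.iSup_le (fun ⟨U, hU⟩ => ?_) (mul_nonneg hM (classSeminorm_nonneg μ R f))
  have hcomp : U.2.integrate μ (leftTranslate r f) = (U.2.op r).comp (U.2.integrate μ f) :=
    ContinuousLinearMap.ext (U.2.integrate_leftTranslate μ r f)
  rw [hcomp]
  refine (ContinuousLinearMap.opNorm_comp_le _ _).trans ?_
  gcongr
  exacts [h U hU, norm_integrate_le_classSeminorm μ hR hU f]

theorem CrossedProduct.continuous_ofCc_leftTranslate (f : C_c(G, 𝕂)) :
    Continuous fun r => CrossedProduct.ofCc μ hR (leftTranslate r f) := by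
  refine continuous_iff_continuousAt.2 fun r₀ => ?_
  obtain ⟨K, hK, hKr⟩ := exists_compact_mem_nhds r₀
  obtain ⟨M, hM, hRM⟩ := hR.exists_bound (hK.mul f.hasCompactSupport.isCompact)
  refine tendsto_iff_norm_sub_tendsto_zero.2 (squeeze_zero' (.of_forall fun _ => norm_nonneg _) ?_
    (by simpa using (tendsto_integral_norm_leftTranslate_sub μ f r₀).const_mul M))
  filter_upwards [hKr] with r hr
  rw [← map_sub]
  exact CrossedProduct.norm_ofCc_le μ hR hM fun U hU s hs => hRM U hU s
    (tsupport_leftTranslate_sub_subset hK hr (mem_of_mem_nhds hKr) f hs)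

end CrossedProduct

section DenseExtension

theorem continuousAt_apply_of_denseRange {𝕂 G E F W : Type*} [RCLike 𝕂]
    [TopologicalSpace G] [NormedAddCommGroup E] [NormedSpace 𝕂 E] [NormedAddCommGroup F]
    [NormedSpace 𝕂 F] {e : W → E} (he : DenseRange e) {A : G → E →L[𝕂] F}
    {r₀ : G} {M : ℝ} (hM : ∀ᶠ r in 𝓝 r₀, ‖A r‖ ≤ M)
    (h : ∀ w, ContinuousAt (fun r => A r (e w)) r₀) (x : E) :
    ContinuousAt (fun r => A r x) r₀ := by
  refine continuousAt_of_locally_uniform_approx_of_continuousAt fun u hu => ?_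
  obtain ⟨ε, hε, hεu⟩ := Metric.mem_uniformity_dist.1 hu
  have hM0 : 0 ≤ M := (norm_nonneg _).trans hM.self_of_nhds
  obtain ⟨w, hw⟩ := he.exists_dist_lt x (div_pos hε (by positivity : 0 < M + 1))
  refine ⟨_, hM, _, h w, fun r (hr : ‖A r‖ ≤ M) => hεu ?_⟩
  calc dist (A r x) (A r (e w)) = ‖A r (x - e w)‖ := by rw [dist_eq_norm, map_sub]
    _ ≤ (M + 1) * dist x (e w) := by
        rw [dist_eq_norm]
        exact (A r).le_of_opNorm_le (hr.trans (by linarith)) _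
    _ < ε := by rwa [lt_div_iff₀' (by positivity)] at hw

variable {G : Type*} [Group G] [TopologicalSpace G] {𝕂 : Type*} [RCLike 𝕂] {X : BanachSp 𝕂}
  {W : Type*} [AddCommGroup W] [Module 𝕂 W] {e : W →ₗ[𝕂] X}
  {L : Representation 𝕂 G W}

/-- A representation `L` on a vector space `W` mapped linearly onto a dense subspace of `X` by `e`
descends and extends to a strongly continuous representation on `X`, if it is locally bounded for
the seminorm `‖e w‖` and the maps `r ↦ e (L_r w)` are continuous. -/
def StrongContRep.ofDenseRange (he : DenseRange e)
    (hbound : ∀ r₀, ∃ M, ∀ᶠ r in 𝓝 r₀, ∀ w, ‖e (L r w)‖ ≤ M * ‖e w‖)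
    (hcont : ∀ w, Continuous fun r => e (L r w)) : StrongContRep G X :=
  have happly (r : G) (w : W) : (e ∘ₗ L r).extendOfNorm e (e w) = e (L r w) :=
    LinearMap.extendOfNorm_eq he ((hbound r).imp fun _ hM => hM.self_of_nhds) w
  have hext (A B : X →L[𝕂] X) (h : ∀ w, A (e w) = B (e w)) : A = B :=
    DFunLike.coe_injective (he.equalizer A.continuous B.continuous (funext h))
  { toHom := MonoidHom.toHomUnits
      { toFun := fun r => (e ∘ₗ L r).extendOfNorm e
        map_one' := hext _ _ fun w => by
          rw [happly, map_one]
          rfl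
        map_mul' := fun r s => hext _ _ fun w => by
          rw [happly, map_mul, Module.End.mul_apply, mul_apply_eq_comp, happly, happly] }
    continuous_orbit := fun x => continuous_iff_continuousAt.2 fun r₀ => by
      obtain ⟨M, hM⟩ := hbound r₀
      refine continuousAt_apply_of_denseRange (M := max M 0) he ?_ (fun w => ?_) x
      · filter_upwards [hM] with r hr
        exact LinearMap.opNorm_extendOfNorm_le he (le_max_right _ _) fun w => (hr w).trans
          (mul_le_mul_of_nonneg_right (le_max_left _ _) (norm_nonneg _))
      · exact ((hcont w).congr fun r => (happly r w).symm).continuousAt }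

section

variable {he : DenseRange e} {hbound : ∀ r₀, ∃ M, ∀ᶠ r in 𝓝 r₀, ∀ w, ‖e (L r w)‖ ≤ M * ‖e w‖}
  {hcont : ∀ w, Continuous fun r => e (L r w)}

theorem StrongContRep.ofDenseRange_op_apply (r : G) (w : W) :
    (StrongContRep.ofDenseRange he hbound hcont).op r (e w) = e (L r w) :=
  LinearMap.extendOfNorm_eq he ((hbound r).imp fun _ hM => hM.self_of_nhds) w

theorem StrongContRep.norm_ofDenseRange_op_le {r : G} {M : ℝ} (hM : 0 ≤ M)
    (h : ∀ w, ‖e (L r w)‖ ≤ M * ‖e w‖) :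
    ‖(StrongContRep.ofDenseRange he hbound hcont).op r‖ ≤ M :=
  LinearMap.opNorm_extendOfNorm_le he hM h

end

end DenseExtension

section LeftRegular

variable {G : Type*} [Group G] [TopologicalSpace G] [IsTopologicalGroup G] [LocallyCompactSpace G]
  [MeasurableSpace G] [BorelSpace G] {𝕂 : Type*} [RCLike 𝕂] {X : BanachSp 𝕂}
  {U : StrongContRep G X} (μ : Measure G) [μ.IsHaarMeasure] {R : Set (SomeRep G 𝕂)}
  (hR : UniformlyBoundedClass R)

/-- The crossed product as a bundled Banach space. -/
abbrev CrossedProduct.banachSp : BanachSp 𝕂 := ⟨CrossedProduct μ R hR⟩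

/-- The representation `λ` of `G` on the crossed product induced by left translation. -/
def CrossedProduct.leftRegular : StrongContRep G (CrossedProduct.banachSp μ hR) :=
  StrongContRep.ofDenseRange (e := CrossedProduct.ofCc μ hR) (L := leftTranslate)
    (CrossedProduct.denseRange_ofCc μ hR)
    (fun r₀ => by
      obtain ⟨K, hK, hKr⟩ := exists_compact_mem_nhds r₀
      obtain ⟨M, hM, hRM⟩ := hR.exists_bound hK
      exact ⟨M, Filter.mem_of_superset hKr fun r hr =>
        CrossedProduct.norm_ofCc_leftTranslate_le μ hR hM fun U hU => hRM U hU r hr⟩)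
    (CrossedProduct.continuous_ofCc_leftTranslate μ hR)

theorem CrossedProduct.leftRegular_op_ofCc (r : G) (f : C_c(G, 𝕂)) :
    (CrossedProduct.leftRegular μ hR).op r (CrossedProduct.ofCc μ hR f) =
      CrossedProduct.ofCc μ hR (leftTranslate r f) :=
  StrongContRep.ofDenseRange_op_apply r f

theorem CrossedProduct.norm_leftRegular_op_le {r : G} {M : ℝ} (hM : 0 ≤ M)
    (h : ∀ U ∈ R, ‖U.2.op r‖ ≤ M) : ‖(CrossedProduct.leftRegular μ hR).op r‖ ≤ M :=
  StrongContRep.norm_ofDenseRange_op_le hM (CrossedProduct.norm_ofCc_leftTranslate_le μ hR hM h)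

theorem StrongContRep.inducedMap_leftRegular (hU : U.ContinuousFor μ R) (r : G)
    (a : CrossedProduct.banachSp μ hR) :
    U.inducedMap μ hR ((CrossedProduct.leftRegular μ hR).op r a) =
      (U.op r).comp (U.inducedMap μ hR a) := by
  refine (CrossedProduct.denseRange_ofCc μ hR).induction_on
    (p := fun a => U.inducedMap μ hR ((CrossedProduct.leftRegular μ hR).op r a) =
      (U.op r).comp (U.inducedMap μ hR a)) a (isClosed_eq (by fun_prop) (by fun_prop)) fun f => ?_
  ext x
  rw [CrossedProduct.leftRegular_op_ofCc, U.inducedMap_ofCc μ hR hU, U.inducedMap_ofCc μ hR hU]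
  exact U.integrate_leftTranslate μ r f x

theorem CrossedProduct.leftRegular_op_mul (r : G) (a b : CrossedProduct μ R hR) :
    (CrossedProduct.leftRegular μ hR).op r (a * b) =
      (CrossedProduct.leftRegular μ hR).op r a * b := by
  refine CrossedProduct.eq_of_inducedMap_eq μ hR fun U hU => ?_
  have hUc := continuousFor_of_mem μ hR hU
  rw [U.2.inducedMap_leftRegular μ hR hUc, U.2.inducedMap_mul μ hR hUc,
    U.2.inducedMap_mul μ hR hUc, U.2.inducedMap_leftRegular μ hR hUc]
  rfl

theorem CrossedProduct.leftRegular_integrate (f : C_c(G, 𝕂)) (a : CrossedProduct μ R hR) :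
    (CrossedProduct.leftRegular μ hR).integrate μ f a = CrossedProduct.ofCc μ hR f * a := by
  refine CrossedProduct.eq_of_inducedMap_eq μ hR fun U hU => ContinuousLinearMap.ext fun x => ?_
  have hUc := continuousFor_of_mem μ hR hU
  have hint : Intertwines (CrossedProduct.leftRegular μ hR).op U.2.op
      ((U.2.inducedMap μ hR).flip x) := fun r => ContinuousLinearMap.ext fun b =>
    (DFunLike.congr_fun (U.2.inducedMap_leftRegular μ hR hUc r b) x).symm
  rw [U.2.inducedMap_mul μ hR hUc, U.2.inducedMap_ofCc μ hR hUc]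
  exact (DFunLike.congr_fun (hint.integrate μ f) a).symm

end LeftRegular

section Disintegration

open scoped TensorProduct

section

variable {𝕂 : Type*} [RCLike 𝕂] {X : BanachSp 𝕂} {B : Type*} [NonUnitalNormedRing B]
  [NormedSpace 𝕂 B]

theorem continuous_of_norm_apply_le {T : B →ₙₐ[𝕂] (X →L[𝕂] X)} {C : ℝ}
    (hT : ∀ a, ‖T a‖ ≤ C * ‖a‖) : Continuous T :=
  AddMonoidHomClass.continuous_of_bound (T : B →ₗ[𝕂] (X →L[𝕂] X)) C hT

/-- The linear map `a ⊗ x ↦ T(a)x` of a representation `T` of an algebra. Its range is the span in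
the definition of non-degeneracy. -/
def actionMap (T : B →ₙₐ[𝕂] (X →L[𝕂] X)) : B ⊗[𝕂] X →ₗ[𝕂] X :=
  TensorProduct.lift (ContinuousLinearMap.coeLM 𝕂 ∘ₗ (T : B →ₗ[𝕂] (X →L[𝕂] X)))

theorem actionMap_tmul (T : B →ₙₐ[𝕂] (X →L[𝕂] X)) (a : B) (x : X) :
    actionMap T (a ⊗ₜ x) = T a x := rfl

theorem IsNondegenerateRep.denseRange_actionMap {T : B →ₙₐ[𝕂] (X →L[𝕂] X)}
    (hT : IsNondegenerateRep T) : DenseRange (actionMap T) := by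
  refine Dense.mono (SetLike.coe_subset_coe.2 (Submodule.span_le.2 ?_) :
    _ ⊆ ((LinearMap.range (actionMap T) : Submodule 𝕂 X) : Set X)) hT
  rintro _ ⟨a, x, rfl⟩
  exact ⟨a ⊗ₜ x, actionMap_tmul T a x⟩

end

/-- The operators `U_r` as a representation on the underlying vector space. -/
def StrongContRep.toRepresentation {G : Type*} [Group G] [TopologicalSpace G] {𝕂 : Type*}
    [RCLike 𝕂] {X : BanachSp 𝕂} (U : StrongContRep G X) : Representation 𝕂 G X :=
  (ContinuousLinearMap.toLinearMapRingHom : (X →L[𝕂] X) →+* _).toMonoidHom.comp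
    ((Units.coeHom _).comp U.toHom)

variable {G : Type*} [Group G] [TopologicalSpace G] [IsTopologicalGroup G] [LocallyCompactSpace G]
  [MeasurableSpace G] [BorelSpace G] {𝕂 : Type*} [RCLike 𝕂] {X : BanachSp 𝕂}
  (μ : Measure G) [μ.IsHaarMeasure] {R : Set (SomeRep G 𝕂)} (hR : UniformlyBoundedClass R)

/-- The representation `a ⊗ x ↦ λ_r(a) ⊗ x` of `G` on the tensor product of the crossed product
with `X`. -/
def CrossedProduct.leftRegularTensor (X : BanachSp 𝕂) :
    Representation 𝕂 G (CrossedProduct μ R hR ⊗[𝕂] X) :=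
  (CrossedProduct.leftRegular μ hR).toRepresentation.tprod (Representation.trivial 𝕂 G X)

variable {μ hR} {T : CrossedProduct μ R hR →ₙₐ[𝕂] (X →L[𝕂] X)}

theorem continuous_actionMap_leftRegularTensor (hT : Continuous T)
    (w : CrossedProduct μ R hR ⊗[𝕂] X) :
    Continuous fun r => actionMap T (CrossedProduct.leftRegularTensor μ hR X r w) := by
  induction w with
  | zero => simpa only [map_zero] using continuous_const
  | tmul a x =>
    exact (hT.comp ((CrossedProduct.leftRegular μ hR).continuous_op a)).clm_apply continuous_const
  | add w w' hw hw' =>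
    simp only [map_add]
    exact hw.add hw'

theorem tendsto_actionMap_leftRegularTensor (hT : Continuous T) (r : G)
    (w : CrossedProduct μ R hR ⊗[𝕂] X) :
    Tendsto (fun u => T ((CrossedProduct.leftRegular μ hR).op r (CrossedProduct.ofCc μ hR u))
        (actionMap T w)) (approxUnit 𝕂 μ)
      (𝓝 (actionMap T (CrossedProduct.leftRegularTensor μ hR X r w))) := by
  induction w with
  | zero => simpa only [map_zero] using tendsto_const_nhds
  | tmul a x =>
    have hmul (u : C_c(G, 𝕂)) :
        T ((CrossedProduct.leftRegular μ hR).op r (CrossedProduct.ofCc μ hR u)) (T a x) =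
          T ((CrossedProduct.leftRegular μ hR).op r
            ((CrossedProduct.leftRegular μ hR).integrate μ u a)) x := by
      rw [CrossedProduct.leftRegular_integrate, CrossedProduct.leftRegular_op_mul, map_mul]
      rfl
    have hcont : Continuous fun b => T ((CrossedProduct.leftRegular μ hR).op r b) x :=
      (hT.comp ((CrossedProduct.leftRegular μ hR).op r).continuous).clm_apply continuous_const
    simp only [actionMap_tmul, hmul]
    exact (hcont.tendsto a).comp
      ((CrossedProduct.leftRegular μ hR).tendsto_integrate_approxUnit μ a)
  | add w w' hw hw' => simpa only [map_add] using hw.add hw'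

theorem norm_actionMap_leftRegularTensor_le {C : ℝ≥0} (hT : ∀ a, ‖T a‖ ≤ C * ‖a‖) {r : G}
    {c M : ℝ} (hc : 0 ≤ c) (hRc : ∀ U ∈ R, ‖U.2.op r‖ ≤ c) (hM : 0 ≤ M)
    (hRM : ∀ᶠ s in 𝓝 1, ∀ U ∈ R, ‖U.2.op s‖ ≤ M) (w : CrossedProduct μ R hR ⊗[𝕂] X) :
    ‖actionMap T (CrossedProduct.leftRegularTensor μ hR X r w)‖ ≤
      C * (c * M) * ‖actionMap T w‖ := by
  refine le_of_tendsto
    (tendsto_actionMap_leftRegularTensor (continuous_of_norm_apply_le hT) r w).norm ?_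
  filter_upwards [CrossedProduct.eventually_norm_ofCc_le μ hR hM hRM] with u hu
  refine ContinuousLinearMap.le_of_opNorm_le _ ((hT _).trans ?_) _
  gcongr
  exact (ContinuousLinearMap.le_of_opNorm_le _
    (CrossedProduct.norm_leftRegular_op_le μ hR hc hRc) _).trans (by gcongr)

variable {C : ℝ≥0} (hnd : IsNondegenerateRep T) (hT : ∀ a, ‖T a‖ ≤ C * ‖a‖)

/-- The disintegration of a bounded non-degenerate representation `T` of the crossed product: the
representation `U` of `G` with `U_r T(a)x = T(λ_r a)x`. -/
def disintegrate : StrongContRep G X :=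
  StrongContRep.ofDenseRange (L := CrossedProduct.leftRegularTensor μ hR X)
    hnd.denseRange_actionMap
    (fun r₀ => by
      obtain ⟨K, hK, hKr⟩ := exists_compact_mem_nhds r₀
      obtain ⟨K₁, hK₁, hK₁1⟩ := exists_compact_mem_nhds (1 : G)
      obtain ⟨c, hc, hRc⟩ := hR.exists_bound hK
      obtain ⟨M, hM, hRM⟩ := hR.exists_bound hK₁
      refine ⟨C * (c * M), Filter.mem_of_superset hKr fun r hr w => ?_⟩
      exact norm_actionMap_leftRegularTensor_le hT hc (fun U hU => hRc U hU r hr) hM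
        (Filter.mem_of_superset hK₁1 fun s hs U hU => hRM U hU s hs) w)
    (continuous_actionMap_leftRegularTensor (continuous_of_norm_apply_le hT))

theorem disintegrate_op_apply (r : G) (a : CrossedProduct μ R hR) (x : X) :
    (disintegrate hnd hT).op r (T a x) = T ((CrossedProduct.leftRegular μ hR).op r a) x :=
  StrongContRep.ofDenseRange_op_apply r (a ⊗ₜ x)

theorem norm_disintegrate_op_le {r : G} {c : ℝ} (hc : 0 ≤ c) (hRc : ∀ U ∈ R, ‖U.2.op r‖ ≤ c)
    (hR1 : ∀ M : ℝ, 1 < M → ∀ᶠ s in 𝓝 1, ∀ U ∈ R, ‖U.2.op s‖ ≤ M) :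
    ‖(disintegrate hnd hT).op r‖ ≤ C * c := by
  have hle : ∀ᶠ M in 𝓝[>] (1 : ℝ), ‖(disintegrate hnd hT).op r‖ ≤ C * (c * M) := by
    filter_upwards [self_mem_nhdsWithin] with M (hM : 1 < M)
    have hM0 : 0 ≤ M := zero_le_one.trans hM.le
    exact StrongContRep.norm_ofDenseRange_op_le (by positivity)
      (norm_actionMap_leftRegularTensor_le hT hc hRc hM0 (hR1 M hM))
  have hlim : Tendsto (fun M : ℝ => C * (c * M)) (𝓝[>] 1) (𝓝 (C * (c * 1))) :=
    (tendsto_nhdsWithin_of_tendsto_nhds tendsto_id).const_mul c |>.const_mul _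
  simpa only [mul_one] using ge_of_tendsto hlim hle

theorem disintegrate_integrate (f : C_c(G, 𝕂)) :
    (disintegrate hnd hT).integrate μ f = T (CrossedProduct.ofCc μ hR f) := by
  let Tc : CrossedProduct.banachSp μ hR →L[𝕂] (X →L[𝕂] X) :=
    (T : CrossedProduct μ R hR →ₗ[𝕂] (X →L[𝕂] X)).mkContinuous C hT
  have hint (x : X) : Intertwines (CrossedProduct.leftRegular μ hR).op (disintegrate hnd hT).op
      (Tc.flip x) := fun r =>
    ContinuousLinearMap.ext fun a => disintegrate_op_apply hnd hT r a x
  refine ContinuousLinearMap.ext_on hnd ?_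
  rintro _ ⟨a, x, rfl⟩
  calc (disintegrate hnd hT).integrate μ f (T a x)
      = T ((CrossedProduct.leftRegular μ hR).integrate μ f a) x :=
        DFunLike.congr_fun ((hint x).integrate μ f) a
    _ = T (CrossedProduct.ofCc μ hR f) (T a x) := by
        rw [CrossedProduct.leftRegular_integrate, map_mul]
        rfl

theorem induced_disintegrate (hU : (disintegrate hnd hT).ContinuousFor μ R) :
    (disintegrate hnd hT).induced μ hR hU = T := by
  refine DFunLike.coe_injective ((CrossedProduct.denseRange_ofCc μ hR).equalizer
    ((disintegrate hnd hT).inducedMap μ hR).continuous (continuous_of_norm_apply_le hT)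
    (funext fun f => ?_))
  exact ((disintegrate hnd hT).inducedMap_ofCc μ hR hU f).trans (disintegrate_integrate hnd hT f)

end Disintegration

section HilbertSpace

variable {𝕂 : Type*} [RCLike 𝕂] {X : BanachSp 𝕂} (H : HilbertStructure X)

/-- The inner product space underlying a Hilbert space structure, with its normed space structure
replaced by that of `X`, so that Mathlib's theory of adjoints applies to the operators on `X`. -/
abbrev HilbertStructure.toInnerProductSpace : InnerProductSpace 𝕂 X :=
  { H.innerProductSpace with
    toNormedSpace := X.normedSpace
    smul_left := fun x y c => by
      have h := H.innerProductSpace.smul_left x y c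
      rwa [H.compatible] at h }

/-- The adjoint of an operator with respect to a Hilbert space structure. -/
def HilbertStructure.adjoint : (X →L[𝕂] X) ≃ₗᵢ⋆[𝕂] (X →L[𝕂] X) :=
  letI := H.toInnerProductSpace
  ContinuousLinearMap.adjoint

variable {H}

theorem HilbertStructure.eq_adjoint_iff {S T : X →L[𝕂] X} :
    S = H.adjoint T ↔ ∀ x y, H.ip (S x) y = H.ip x (T y) :=
  letI := H.toInnerProductSpace
  ContinuousLinearMap.eq_adjoint_iff S T

theorem HilbertStructure.ip_adjoint_right (T : X →L[𝕂] X) (x y : X) :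
    H.ip x (H.adjoint T y) = H.ip (T x) y :=
  letI := H.toInnerProductSpace
  ContinuousLinearMap.adjoint_inner_right T x y

theorem HilbertStructure.adjoint_adjoint (T : X →L[𝕂] X) : H.adjoint (H.adjoint T) = T :=
  letI := H.toInnerProductSpace
  ContinuousLinearMap.adjoint_adjoint T

theorem HilbertStructure.adjoint_mul (S T : X →L[𝕂] X) :
    H.adjoint (S * T) = H.adjoint T * H.adjoint S :=
  letI := H.toInnerProductSpace
  ContinuousLinearMap.adjoint_comp S T

theorem HilbertStructure.norm_adjoint_mul_self (T : X →L[𝕂] X) :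
    ‖H.adjoint T * T‖ = ‖T‖ * ‖T‖ :=
  letI := H.toInnerProductSpace
  ContinuousLinearMap.norm_adjoint_comp_self T

theorem HilbertStructure.tendsto_ip {ι : Type*} {l : Filter ι} {f g : ι → X} {x y : X}
    (hf : Tendsto f l (𝓝 x)) (hg : Tendsto g l (𝓝 y)) :
    Tendsto (fun i => H.ip (f i) (g i)) l (𝓝 (H.ip x y)) :=
  letI := H.toInnerProductSpace
  hf.inner hg

theorem HilbertStructure.ip_integral_smul {α : Type*} {m : MeasurableSpace α} {μ : Measure α}
    {f : α → 𝕂} {φ : α → X} (h : Integrable (fun s => f s • φ s) μ) (x : X) :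
    H.ip x (∫ s, f s • φ s ∂μ) = ∫ s, f s * H.ip x (φ s) ∂μ := by
  let := H.toInnerProductSpace
  exact (integral_inner h x).symm.trans (by simp only [inner_smul_right]; rfl)

theorem HilbertStructure.conj_ip (x y : X) : starRingEnd 𝕂 (H.ip y x) = H.ip x y :=
  H.innerProductSpace.conj_inner_symm x y

end HilbertSpace

section Inversion

variable {G : Type*} [Group G] [TopologicalSpace G] [IsTopologicalGroup G] [LocallyCompactSpace G]

theorem continuous_modularFunction : Continuous fun r : G => (modularFunction r : ℝ) :=
  continuous_modularCharacterFun.comp continuous_inv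

variable [MeasurableSpace G] [BorelSpace G] (μ : Measure G) [μ.IsHaarMeasure]

theorem integral_modularFunction_inv_mul {φ : G → ℝ} (hφ : Continuous φ)
    (hφc : HasCompactSupport φ) :
    ∫ s, (modularFunction s⁻¹ : ℝ) * φ s⁻¹ ∂μ = ∫ s, φ s ∂μ := by
  obtain ⟨g, hgc, hg0, hg1⟩ := exists_continuous_nonneg_pos (1 : G)
  have hpos : ∫ s, g s ∂μ ≠ 0 :=
    (g.continuous.integral_pos_of_hasCompactSupport_nonneg_nonzero hgc hg0 hg1).ne'
  have hdensity (r : G) : (∫ z, g (z * r) ∂μ)⁻¹ * ∫ s, g s ∂μ = modularFunction r := by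
    have hr : modularFunction r * ∫ z, g (z * r) ∂μ = ∫ s, g s ∂μ :=
      modularFunction_integral μ ⟨g, hgc⟩ r
    rw [← hr] at hpos ⊢
    field_simp [right_ne_zero_of_mul hpos]
  have hinv (F : G → ℝ) : ∫ s, F s ∂μ.inv = ∫ s, F s⁻¹ ∂μ :=
    integral_map_equiv (MeasurableEquiv.inv G) F
  have hμ := Measure.integral_isMulLeftInvariant_isMulRightInvariant_combo (μ := μ) (ν := μ.inv)
    hφ hφc g.continuous hgc hg0 hg1
  simp only [hinv, inv_inv] at hμ
  rw [hμ, ← integral_mul_const]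
  simp only [mul_assoc, hdensity]
  simp only [mul_comm]

theorem integral_modularFunction_inv_smul {E : Type*} [NormedAddCommGroup E] [NormedSpace ℝ E]
    [CompleteSpace E] {φ : G → E} (hφ : Continuous φ) (hφc : HasCompactSupport φ) :
    ∫ s, (modularFunction s⁻¹ : ℝ) • φ s⁻¹ ∂μ = ∫ s, φ s ∂μ := by
  have hint : Integrable (fun s => (modularFunction s⁻¹ : ℝ) • φ s⁻¹) μ :=
    ((continuous_modularFunction.smul hφ).comp continuous_inv).integrable_of_hasCompactSupport
      (hφc.smul_left.comp_homeomorph (Homeomorph.inv G))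
  refine (SeparatingDual.eq_iff_forall_dual_eq (R := ℝ)).2 fun L => ?_
  rw [← L.integral_comp_comm hint, ← L.integral_comp_comm (hφ.integrable_of_hasCompactSupport hφc)]
  simp only [map_smul, smul_eq_mul]
  exact integral_modularFunction_inv_mul μ (L.continuous.comp hφ) (hφc.comp_left (map_zero L))

end Inversion

section Unitary

variable {G : Type*} [Group G] [TopologicalSpace G] {𝕂 : Type*} [RCLike 𝕂] {X : BanachSp 𝕂}
  {H : HilbertStructure X} {U : StrongContRep G X}

theorem StrongContRep.op_inv_mul_op (U : StrongContRep G X) (r : G) : U.op r⁻¹ * U.op r = 1 := by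
  simp only [StrongContRep.op, map_inv, Units.inv_mul]

theorem HilbertStructure.ip_op_left
    (hU : ∀ (r : G) (x y : X), H.ip (U.op r x) (U.op r y) = H.ip x y) (r : G) (x y : X) :
    H.ip (U.op r x) y = H.ip x (U.op r⁻¹ y) := by
  have hy : U.op r (U.op r⁻¹ y) = y := by
    simpa only [inv_inv, mul_apply_eq_comp, one_apply_eq_self] using
      DFunLike.congr_fun (U.op_inv_mul_op r⁻¹) y
  rw [← hU r x (U.op r⁻¹ y), hy]

theorem HilbertStructure.adjoint_op
    (hU : ∀ (r : G) (x y : X), H.ip (U.op r x) (U.op r y) = H.ip x y) (r : G) :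
    H.adjoint (U.op r) = U.op r⁻¹ :=
  (HilbertStructure.eq_adjoint_iff.2 fun x y => by rw [H.ip_op_left hU, inv_inv]).symm

variable [IsTopologicalGroup G] [LocallyCompactSpace G]

theorem groupInvolution_apply (f : C_c(G, 𝕂)) (s : G) :
    groupInvolution f s = ((modularFunction s⁻¹ : ℝ) : 𝕂) * (starRingEnd 𝕂) (f s⁻¹) := rfl

theorem groupInvolution_add (f g : C_c(G, 𝕂)) :
    groupInvolution (f + g) = groupInvolution f + groupInvolution g := by
  ext s
  simp only [groupInvolution_apply, CompactlySupportedContinuousMap.coe_add, Pi.add_apply,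
    map_add, mul_add]

theorem groupInvolution_smul (c : 𝕂) (f : C_c(G, 𝕂)) :
    groupInvolution (c • f) = (starRingEnd 𝕂) c • groupInvolution f := by
  ext s
  simp only [groupInvolution_apply, CompactlySupportedContinuousMap.coe_smul, Pi.smul_apply,
    smul_eq_mul, map_mul, mul_left_comm]

variable [MeasurableSpace G] [BorelSpace G] (μ : Measure G) [μ.IsHaarMeasure]

theorem StrongContRep.integrate_groupInvolution
    (hU : ∀ (r : G) (x y : X), H.ip (U.op r x) (U.op r y) = H.ip x y) (f : C_c(G, 𝕂)) :
    U.integrate μ (groupInvolution f) = H.adjoint (U.integrate μ f) := by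
  refine HilbertStructure.eq_adjoint_iff.2 fun x y => ?_
  have hcont : Continuous fun s => f s * H.ip x (U.op s y) :=
    (map_continuous f).mul (continuous_iff_continuousAt.2 fun s =>
      H.tendsto_ip tendsto_const_nhds (U.continuous_op y).continuousAt)
  calc H.ip (U.integrate μ (groupInvolution f) x) y
      = starRingEnd 𝕂 (∫ s, groupInvolution f s * H.ip y (U.op s x) ∂μ) := by
        rw [← H.ip_integral_smul (U.integrable μ _ x), H.conj_ip, U.integrate_apply μ]
    _ = ∫ s, (modularFunction s⁻¹ : ℝ) • (f s⁻¹ * H.ip x (U.op s⁻¹ y)) ∂μ := by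
        rw [← integral_conj]
        simp only [groupInvolution_apply, map_mul, RCLike.conj_ofReal, RCLike.conj_conj, H.conj_ip,
          H.ip_op_left hU, mul_assoc, RCLike.real_smul_eq_coe_mul]
    _ = ∫ s, f s * H.ip x (U.op s y) ∂μ :=
        integral_modularFunction_inv_smul μ hcont f.hasCompactSupport.mul_right
    _ = H.ip x (U.integrate μ f y) := (H.ip_integral_smul (U.integrable μ f y) x).symm

variable {R : Set (SomeRep G 𝕂)} (hR : UniformlyBoundedClass R)

namespace CrossedProduct

theorem norm_ofCc_groupInvolution_le (hu : ∀ U ∈ R, IsUnitaryRep U.2) (f : C_c(G, 𝕂)) :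
    ‖ofCc μ hR (groupInvolution f)‖ ≤ ‖ofCc μ hR f‖ :=
  norm_le μ hR (norm_nonneg _) fun U hU => by
    obtain ⟨H, hH⟩ := hu U hU
    rw [U.2.inducedMap_ofCc μ hR (continuousFor_of_mem μ hR hU), norm_ofCc,
      U.2.integrate_groupInvolution μ hH, H.adjoint.norm_map]
    exact norm_integrate_le_classSeminorm μ hR hU f

/-- The involution of the crossed product: the continuous extension of that of `C_c(G)`, provided
that all elements of `R` are unitary. -/
def involution : CrossedProduct μ R hR →SL[starRingEnd 𝕂] CrossedProduct μ R hR :=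
  LinearMap.extendOfNorm
    { toFun := fun f => ofCc μ hR (groupInvolution f)
      map_add' := fun f g => by rw [groupInvolution_add, map_add]
      map_smul' := fun c f => by rw [groupInvolution_smul, map_smul] } (ofCc μ hR)

theorem involution_ofCc (hu : ∀ U ∈ R, IsUnitaryRep U.2) (f : C_c(G, 𝕂)) :
    involution μ hR (ofCc μ hR f) = ofCc μ hR (groupInvolution f) :=
  LinearMap.extendOfNorm_eq (denseRange_ofCc μ hR)
    ⟨1, fun f => (norm_ofCc_groupInvolution_le μ hR hu f).trans_eq (one_mul _).symm⟩ f

end CrossedProduct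

theorem StrongContRep.inducedMap_involution (hu : ∀ U ∈ R, IsUnitaryRep U.2)
    (hUc : U.ContinuousFor μ R) (hU : ∀ (r : G) (x y : X), H.ip (U.op r x) (U.op r y) = H.ip x y)
    (a : CrossedProduct μ R hR) :
    U.inducedMap μ hR (CrossedProduct.involution μ hR a) = H.adjoint (U.inducedMap μ hR a) := by
  refine (CrossedProduct.denseRange_ofCc μ hR).induction_on
    (p := fun a => U.inducedMap μ hR (CrossedProduct.involution μ hR a) =
      H.adjoint (U.inducedMap μ hR a)) a
    (isClosed_eq (by fun_prop) (H.adjoint.continuous.comp (by fun_prop))) fun f => ?_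
  rw [CrossedProduct.involution_ofCc μ hR hu, U.inducedMap_ofCc μ hR hUc,
    U.inducedMap_ofCc μ hR hUc, U.integrate_groupInvolution μ hU]

namespace CrossedProduct

variable {hR}

theorem involution_involution (hu : ∀ U ∈ R, IsUnitaryRep U.2) (a : CrossedProduct μ R hR) :
    involution μ hR (involution μ hR a) = a :=
  eq_of_inducedMap_eq μ hR fun U hU => by
    obtain ⟨H, hH⟩ := hu U hU
    have hUc := continuousFor_of_mem μ hR hU
    rw [U.2.inducedMap_involution μ hR hu hUc hH, U.2.inducedMap_involution μ hR hu hUc hH,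
      H.adjoint_adjoint]

theorem involution_mul (hu : ∀ U ∈ R, IsUnitaryRep U.2) (a b : CrossedProduct μ R hR) :
    involution μ hR (a * b) = involution μ hR b * involution μ hR a :=
  eq_of_inducedMap_eq μ hR fun U hU => by
    obtain ⟨H, hH⟩ := hu U hU
    have hUc := continuousFor_of_mem μ hR hU
    simp only [U.2.inducedMap_involution μ hR hu hUc hH, U.2.inducedMap_mul μ hR hUc,
      H.adjoint_mul]

theorem norm_mul_self_le_norm_involution_mul_self (hu : ∀ U ∈ R, IsUnitaryRep U.2)
    (a : CrossedProduct μ R hR) : ‖a‖ * ‖a‖ ≤ ‖involution μ hR a * a‖ := by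
  rw [← sq, ← Real.le_sqrt (norm_nonneg a) (norm_nonneg _)]
  refine norm_le μ hR (Real.sqrt_nonneg _) fun U hU => Real.le_sqrt_of_sq_le ?_
  obtain ⟨H, hH⟩ := hu U hU
  have hUc := continuousFor_of_mem μ hR hU
  calc ‖U.2.inducedMap μ hR a‖ ^ 2 = ‖U.2.inducedMap μ hR (involution μ hR a * a)‖ := by
        rw [U.2.inducedMap_mul μ hR hUc, U.2.inducedMap_involution μ hR hu hUc hH,
          H.norm_adjoint_mul_self, sq]
    _ ≤ ‖involution μ hR a * a‖ := norm_inducedMap_le μ hR hU _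

theorem involution_leftRegular_mul_leftRegular (hu : ∀ U ∈ R, IsUnitaryRep U.2) (r : G)
    (a b : CrossedProduct.banachSp μ hR) :
    involution μ hR ((leftRegular μ hR).op r a) * (leftRegular μ hR).op r b =
      involution μ hR a * b :=
  eq_of_inducedMap_eq μ hR fun U hU => by
    obtain ⟨H, hH⟩ := hu U hU
    have hUc := continuousFor_of_mem μ hR hU
    simp only [U.2.inducedMap_mul μ hR hUc, U.2.inducedMap_involution μ hR hu hUc hH,
      U.2.inducedMap_leftRegular μ hR hUc, ← ContinuousLinearMap.mul_def, H.adjoint_mul]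
    rw [H.adjoint_op hH, mul_assoc, ← mul_assoc (U.2.op r⁻¹), U.2.op_inv_mul_op, one_mul]

/-- The involution of the crossed product of a class of unitary representations as a star ring
structure. -/
@[reducible]
def starRing (hu : ∀ U ∈ R, IsUnitaryRep U.2) : StarRing (CrossedProduct μ R hR) where
  star := involution μ hR
  star_involutive := involution_involution μ hu
  star_mul := involution_mul μ hu
  star_add := map_add (involution μ hR)

end CrossedProduct

theorem isUnitaryRep_iff_isInvolutiveRep_induced (hu : ∀ U ∈ R, IsUnitaryRep U.2)
    (hU : U.ContinuousFor μ R) :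
    letI := CrossedProduct.starRing μ (hR := hR) hu
    IsUnitaryRep U ↔ IsInvolutiveRep (U.induced μ hR hU) := by
  let := CrossedProduct.starRing μ (hR := hR) hu
  refine ⟨fun ⟨H, hH⟩ => ⟨H, fun a x y => ?_⟩, fun ⟨H, hH⟩ => ⟨H, fun r x y => ?_⟩⟩
  · change _ = H.ip x (U.inducedMap μ hR (CrossedProduct.involution μ hR a) y)
    rw [U.inducedMap_involution μ hR hu hU hH, H.ip_adjoint_right]
    rfl
  have hip (a b : CrossedProduct μ R hR) :
      H.ip (U.inducedMap μ hR a x) (U.inducedMap μ hR b y) =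
        H.ip x (U.inducedMap μ hR (CrossedProduct.involution μ hR a * b) y) := by
    rw [U.inducedMap_mul μ hR hU]
    exact hH a x (U.inducedMap μ hR b y)
  have hisom (a b : CrossedProduct μ R hR) :
      H.ip (U.op r (U.inducedMap μ hR a x)) (U.op r (U.inducedMap μ hR b y)) =
        H.ip (U.inducedMap μ hR a x) (U.inducedMap μ hR b y) := by
    rw [hip a, ← CrossedProduct.involution_leftRegular_mul_leftRegular μ hu r a b, ← hip,
      U.inducedMap_leftRegular μ hR hU, U.inducedMap_leftRegular μ hR hU]
    rfl
  have hlim (z : X) := U.tendsto_integrate_approxUnit μ z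
  refine tendsto_nhds_unique (H.tendsto_ip
    (((U.op r).continuous.tendsto x).comp (hlim x)) (((U.op r).continuous.tendsto y).comp (hlim y)))
    ((H.tendsto_ip (hlim x) (hlim y)).congr fun u => ?_)
  simpa only [Function.comp_apply, U.inducedMap_ofCc μ hR hU] using
    (hisom (CrossedProduct.ofCc μ hR u) (CrossedProduct.ofCc μ hR u)).symm

end Unitary

section Bijection

variable {G : Type*} [Group G] [TopologicalSpace G] {ν : G → ℝ≥0}

theorem eventually_le_of_iInf_iSup_eq_one {𝓩 : Set (Set G)}
    (h𝓩 : (𝓝 (1 : G)).HasBasis (fun V : Set G => V ∈ 𝓩) id)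
    (hbdd : ∀ V ∈ 𝓩, BddAbove (ν '' V)) (hν1 : (⨅ V : 𝓩, ⨆ r : (V : Set G), ν r) = 1)
    {c : ℝ≥0} (hc : 1 < c) : ∀ᶠ r in 𝓝 (1 : G), ν r ≤ c := by
  obtain ⟨V₀, hV₀, -⟩ := h𝓩.mem_iff.1 Filter.univ_mem
  have : Nonempty 𝓩 := ⟨⟨V₀, hV₀⟩⟩
  obtain ⟨⟨V, hV⟩, hVc⟩ := exists_lt_of_ciInf_lt (hν1.trans_lt hc)
  have hVbdd : BddAbove (Set.range fun r : V => ν r) := Set.image_eq_range ν V ▸ hbdd V hV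
  exact mem_of_superset (h𝓩.mem_of_mem hV) fun r hr => (le_ciSup hVbdd ⟨r, hr⟩).trans hVc.le

variable [IsTopologicalGroup G] [LocallyCompactSpace G] [MeasurableSpace G] [BorelSpace G]
  {𝕂 : Type*} [RCLike 𝕂] (μ : Measure G) [μ.IsHaarMeasure] {R : Set (SomeRep G 𝕂)}
  (hR : UniformlyBoundedClass R)

theorem inducedRep_injective : Function.Injective fun U : R => inducedRep μ hR U.1 U.2 := by
  rintro ⟨⟨X, U⟩, hU⟩ ⟨⟨Y, V⟩, hV⟩ h
  obtain rfl : X = Y := congrArg Sigma.fst h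
  obtain rfl : U = V :=
    StrongContRep.eq_of_induced_eq μ hR _ _ (eq_of_heq (Sigma.mk.inj h).2)
  rfl

theorem inducedRep_mem_nondegContractiveReps {𝓧 : Set (BanachSp 𝕂)} {U : SomeRep G 𝕂}
    (hU : U ∈ R) (hX : U.1 ∈ 𝓧) :
    inducedRep μ hR U hU ∈ nondegContractiveReps (CrossedProduct μ R hR) 𝓧 :=
  ⟨hX, U.2.isNondegenerateRep_induced μ hR (continuousFor_of_mem μ hR hU),
    norm_inducedMap_le μ hR hU⟩

variable {μ hR}

theorem exists_mem_boundedReps_inducedRep_eq {𝓧 : Set (BanachSp 𝕂)}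
    (hRν : ∀ U ∈ R, ∀ r, ‖U.2.op r‖ ≤ ν r) (hν1 : ∀ c : ℝ≥0, 1 < c → ∀ᶠ r in 𝓝 1, ν r ≤ c)
    (hsub : boundedReps 𝓧 ν ⊆ R) {T : SomeAlgRep (𝕂 := 𝕂) (CrossedProduct μ R hR)}
    (hT : T ∈ nondegContractiveReps (CrossedProduct μ R hR) 𝓧) :
    ∃ U, ∃ hU : U ∈ boundedReps 𝓧 ν, inducedRep μ hR U (hsub hU) = T := by
  obtain ⟨hX, hnd, hcontr⟩ := hT
  have hT1 (a : CrossedProduct μ R hR) : ‖T.2 a‖ ≤ (1 : ℝ≥0) * ‖a‖ := by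
    simpa only [NNReal.coe_one, one_mul] using hcontr a
  have hR1 (M : ℝ) (hM : 1 < M) : ∀ᶠ s in 𝓝 1, ∀ U ∈ R, ‖U.2.op s‖ ≤ M := by
    lift M to ℝ≥0 using zero_le_one.trans hM.le
    filter_upwards [hν1 M (mod_cast hM)] with s hs U hU
    exact (hRν U hU s).trans (mod_cast hs)
  refine ⟨⟨T.1, disintegrate hnd hT1⟩, ⟨hX, fun r => ?_⟩,
    congrArg (Sigma.mk T.1) (induced_disintegrate hnd hT1 _)⟩
  simpa only [NNReal.coe_one, one_mul] using
    norm_disintegrate_op_le hnd hT1 (ν r).coe_nonneg (fun U hU => hRν U hU r) hR1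

end Bijection

end

theorem theoremt_general {𝕂 : Type w} [RCLike 𝕂]
    {G : Type u} [Group G] [TopologicalSpace G] [IsTopologicalGroup G] [LocallyCompactSpace G]
    [MeasurableSpace G] [BorelSpace G] (μ : Measure G) [μ.IsHaarMeasure]
    (ν : G → ℝ≥0) (hν : ∀ K : Set G, IsCompact K → BddAbove (ν '' K))
    (hν1 : ∀ c : ℝ≥0, 1 < c → ∀ᶠ r in 𝓝 1, ν r ≤ c)
    (R : Set (SomeRep.{u, w, v} G 𝕂)) (hRν : ∀ U ∈ R, ∀ r : G, ‖U.2.op r‖ ≤ ν r)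
    (𝓧 : Set (BanachSp.{w, v} 𝕂)) (hsub : boundedReps 𝓧 ν ⊆ R) :
    let hR : UniformlyBoundedClass R := ⟨ν, hν, hRν⟩
    let Ψ : boundedReps 𝓧 ν → SomeAlgRep.{max u w, w, v} (𝕂 := 𝕂) (CrossedProduct μ R hR) :=
      fun U => inducedRep μ hR U.1 (hsub U.2)
    (Function.Injective Ψ ∧
      Set.range Ψ = nondegContractiveReps (CrossedProduct μ R hR) 𝓧) ∧
    (∀ (U : boundedReps 𝓧 ν) (Z : Submodule 𝕂 U.1.1), IsClosed (Z : Set U.1.1) →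
      (IsInvariantUnder (fun r : G => U.1.2.op r) Z ↔
        IsInvariantUnder (fun a : CrossedProduct μ R hR => (Ψ U).2 a) Z)) ∧
    (∀ (U V : boundedReps 𝓧 ν) (Φ : U.1.1 →L[𝕂] V.1.1),
      Intertwines (fun r : G => U.1.2.op r) (fun r : G => V.1.2.op r) Φ ↔
        Intertwines (fun a : CrossedProduct μ R hR => (Ψ U).2 a)
          (fun a : CrossedProduct μ R hR => (Ψ V).2 a) Φ) ∧
    ((∀ U ∈ R, IsUnitaryRep U.2) →
      ∃ _ : StarRing (CrossedProduct μ R hR),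
        StarModule 𝕂 (CrossedProduct μ R hR) ∧ CStarRing (CrossedProduct μ R hR) ∧
        (∀ f : C_c(G, 𝕂), star (CrossedProduct.q μ R hR f) =
          CrossedProduct.q μ R hR (groupInvolution f)) ∧
        ∀ U : boundedReps 𝓧 ν, IsUnitaryRep U.1.2 ↔ IsInvolutiveRep (Ψ U).2) := by
  intro hR Ψ
  have hc (U : boundedReps 𝓧 ν) : U.1.2.ContinuousFor μ R := continuousFor_of_mem μ hR (hsub U.2)
  refine ⟨⟨?_, Set.Subset.antisymm ?_ ?_⟩, ?_, ?_, fun hu => ?_⟩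
  · exact (inducedRep_injective μ hR).comp (Set.inclusion_injective hsub)
  · rintro _ ⟨U, rfl⟩
    exact inducedRep_mem_nondegContractiveReps μ hR (hsub U.2) U.2.1
  · intro T hT
    obtain ⟨U, hU, rfl⟩ := exists_mem_boundedReps_inducedRep_eq hRν hν1 hsub hT
    exact ⟨⟨U, hU⟩, rfl⟩
  · exact fun U Z hZ => (isInvariantUnder_induced_iff μ hR (hc U) hZ).symm
  · exact fun U V Φ => (intertwines_induced_iff μ hR (hc U) (hc V)).symm
  · let _ := CrossedProduct.starRing μ (hR := hR) hu
    exact ⟨inferInstance, ⟨map_smulₛₗ (CrossedProduct.involution μ hR)⟩,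
      ⟨CrossedProduct.norm_mul_self_le_norm_involution_mul_self μ hu⟩,
      CrossedProduct.involution_ofCc μ hR hu,
      fun U => isUnitaryRep_iff_isInvolutiveRep_induced μ hR hu (hc U)⟩

theorem theoremt {𝕂 : Type w} [RCLike 𝕂]
    {G : Type u} [Group G] [TopologicalSpace G] [IsTopologicalGroup G] [LocallyCompactSpace G]
    [T2Space G] [MeasurableSpace G] [BorelSpace G] (μ : Measure G) [μ.IsHaarMeasure]
    (𝓩 : Set (Set G)) (h𝓩 : (𝓝 (1 : G)).HasBasis (fun V : Set G => V ∈ 𝓩) id)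
    (K₀ : Set G) (hK₀ : IsCompact K₀) (h𝓩K₀ : ∀ V ∈ 𝓩, V ⊆ K₀)
    (ν : G → ℝ≥0) (hν : ∀ K : Set G, IsCompact K → BddAbove (ν '' K))
    (hν1 : (⨅ V : 𝓩, ⨆ r : (V : Set G), ν r) = 1)
    (R : Set (SomeRep.{u, w, v} G 𝕂)) (hRne : R.Nonempty)
    (hRν : ∀ U ∈ R, ∀ r : G, ‖U.2.op r‖ ≤ ν r)
    (𝓧 : Set (BanachSp.{w, v} 𝕂)) (hsub : boundedReps 𝓧 ν ⊆ R) :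
    let hR : UniformlyBoundedClass R := ⟨ν, hν, hRν⟩
    let Ψ : boundedReps 𝓧 ν → SomeAlgRep.{max u w, w, v} (𝕂 := 𝕂) (CrossedProduct μ R hR) :=
      fun U => inducedRep μ hR U.1 (hsub U.2)
    -- `U ↦ U^R` is a bijection onto the non-degenerate contractive representations
    (Function.Injective Ψ ∧
      Set.range Ψ = nondegContractiveReps (CrossedProduct μ R hR) 𝓧) ∧
    -- it preserves the set of closed invariant subspaces
    (∀ (U : boundedReps 𝓧 ν) (Z : Submodule 𝕂 U.1.1), IsClosed (Z : Set U.1.1) →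
      (IsInvariantUnder (fun r : G => U.1.2.op r) Z ↔
        IsInvariantUnder (fun a : CrossedProduct μ R hR => (Ψ U).2 a) Z)) ∧
    -- it preserves the bounded intertwining operators
    (∀ (U V : boundedReps 𝓧 ν) (Φ : U.1.1 →L[𝕂] V.1.1),
      Intertwines (fun r : G => U.1.2.op r) (fun r : G => V.1.2.op r) Φ ↔
        Intertwines (fun a : CrossedProduct μ R hR => (Ψ U).2 a)
          (fun a : CrossedProduct μ R hR => (Ψ V).2 a) Φ) ∧
    -- if all elements of `R` are unitary, the crossed product is a `C*`-algebra, with the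
    -- involution extending that of `C_c(G)`, and unitary corresponds to involutive
    ((∀ U ∈ R, IsUnitaryRep U.2) →
      ∃ _ : StarRing (CrossedProduct μ R hR),
        StarModule 𝕂 (CrossedProduct μ R hR) ∧ CStarRing (CrossedProduct μ R hR) ∧
        (∀ f : C_c(G, 𝕂), star (CrossedProduct.q μ R hR f) =
          CrossedProduct.q μ R hR (groupInvolution f)) ∧
        ∀ U : boundedReps 𝓧 ν, IsUnitaryRep U.1.2 ↔ IsInvolutiveRep (Ψ U).2) :=
  theoremt_general μ ν hν (fun _ => eventually_le_of_iInf_iSup_eq_one h𝓩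
    (fun V hV => (hν K₀ hK₀).mono (Set.image_mono (h𝓩K₀ V hV))) hν1) R hRν 𝓧 hsub
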